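/- Let $(X,\mathrm dx)$ and $(Y,\mathrm dy)$ be probability spaces, let $X\times Y$ carry the product measure $\mathrm dx\,\mathrm dy$, and let $n\in\mathbb N$. Let $F_1:L^1(X)^n\to\mathbb R\cup\{\infty\}$ and $F_2:L^1(Y)^n\to\mathbb R\cup\{\infty\}$ be convex, proper (not identically $+\infty$) and weakly lower semicontinuous, let $K\in L^\infty_+(X\times Y)^n$ and let $\varepsilon>0$. For $r\in L^1(X\times Y)^n$ let $(P^X_\# r)_k(x)=\int_Y r_k(x,y)\,\mathrm dy$ and $(P^Y_\# r)_k(y)=\int_X r_k(x,y)\,\mathrm dx$, and let $$\mathrm{KL}(r|K)=\sum_{k=1}^n\int_{X\times Y}\Big[r_k\log\frac{r_k}{K_k}-r_k+K_k\Big]\,\mathrm dx\,\mathrm dy$$ (with $0\log(0/0)=0$) if $r\ge 0$ a.e. and, for every $k$, $r_k=0$ a.e. on $\{K_k=0\}$, and $\mathrm{KL}(r|K)=\infty$ otherwise. Write $\langle f,g\rangle=\sum_k\int f_kg_k$ and $(u\oplus v)_k(x,y)=u_k(x)+v_k(y)$. For a functional $F$ on $L^1(T)^n$ and $a\in L^\infty(T)^n$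 let $F^*(a)=\sup_{s\in L^1(T)^n}\langle s,a\rangle-F(s)$; let $\partial F(s)$ be the set of all $a\in L^\infty(T)^n$ with $F(s')\ge F(s)+\langle s'-s,a\rangle$ for all $s'\in L^1(T)^n$ if $F(s)<\infty$, and $\partial F(s)=\emptyset$ if $F(s)=\infty$. Consider the problem $$\min_{r\in L^1(X\times Y)^n}\ F_1(P^X_\# r)+F_2(P^Y_\# r)+\varepsilon\,\mathrm{KL}(r|K).\tag{$P_\varepsilon$}$$ (i) Its Fenchel--Rockafellar dual, that is, the maximization of $-F_1^*(-u)-F_2^*(-v)-(\varepsilon\,\mathrm{KL}(\cdot|K))^*(u\oplus v)$, is $$\sup_{(u,v)\in L^\infty(X)^n\times L^\infty(Y)^n}\ -F_1^*(-u)-F_2^*(-v)-\varepsilon\,\big\langle e^{(u\oplus v)/\varepsilon}-1,\,K\big\rangle,\tag{$D_\varepsilon$}$$ the two objectives being equal at every $(u,v)$. (ii) Strong duality holds: the minimum in $(P_\varepsilon)$ is attained and $\min(P_\varepsilon)=\sup(D_\varepsilon)$, as elements of $\mathbb R\cup\{+\infty\}$. (iii) If $(P_\varepsilon)$ is feasible,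 i.e. its objective is finite at some $r$, then its minimizer is unique. (iv) Let $r$ be a minimizer of $(P_\varepsilon)$, and let $(u,v)\in L^\infty(X)^n\times L^\infty(Y)^n$. Then $(u,v)$ maximizes $(D_\varepsilon)$ if and only if $$-u\in\partial F_1(P^X_\# r),\qquad -v\in\partial F_2(P^Y_\# r),\qquad r_k(x,y)=e^{u_k(x)/\varepsilon}K_k(x,y)\,e^{v_k(y)/\varepsilon}\ \text{ for a.e. }(x,y)\text{ and all }k=1,\dots,n.$$ -/

import Mathlib

open MeasureTheory
open scoped ENNReal

noncomputable section

namespace EntropicDuality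

/-- The space `L¹(T)ⁿ` of families of `n` classes of integrable functions. -/
abbrev L1n (n : ℕ) {T : Type*} [MeasurableSpace T] (τ : Measure T) : Type _ :=
  Fin n → Lp ℝ 1 τ

/-- The space `L^∞(T)ⁿ` of families of `n` classes of essentially bounded functions. -/
abbrev Linfn (n : ℕ) {T : Type*} [MeasurableSpace T] (τ : Measure T) : Type _ :=
  Fin n → Lp ℝ ∞ τ

section Functionals

variable {n : ℕ} {T : Type*} [MeasurableSpace T] {τ : Measure T}

/-- The duality pairing `⟨s, a⟩ = ∑ₖ ∫ sₖ aₖ` between `L¹(T)ⁿ` and `L^∞(T)ⁿ`. -/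
def pairing (s : L1n n τ) (a : Linfn n τ) : ℝ :=
  ∑ k, ∫ t, s k t * a k t ∂τ

/-- `F` takes values in `ℝ ∪ {+∞}` and is not identically `+∞`. -/
def IsProper (F : L1n n τ → EReal) : Prop :=
  (∀ s, F s ≠ ⊥) ∧ ∃ s, F s ≠ ⊤

/-- Convexity of an extended-real-valued functional. -/
def IsConvex (F : L1n n τ → EReal) : Prop :=
  ∀ s t : L1n n τ, ∀ a b : ℝ, 0 ≤ a → 0 ≤ b → a + b = 1 →
    F (a • s + b • t) ≤ (a : EReal) * F s + (b : EReal) * F t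

/-- Lower semicontinuity for the weak topology of `L¹(T)ⁿ`. -/
def IsWeaklyLSC (F : L1n n τ → EReal) : Prop :=
  LowerSemicontinuous
    (fun s : WeakSpace ℝ (L1n n τ) => F ((toWeakSpace ℝ (L1n n τ)).symm s))

/-- The convex conjugate `F*(a) = sup_s ⟨s, a⟩ - F(s)`. -/
def conj (F : L1n n τ → EReal) (a : Linfn n τ) : EReal :=
  ⨆ s : L1n n τ, (pairing s a : EReal) - F s

/-- The subdifferential `∂F(s) ⊆ L^∞(T)ⁿ`; it is empty where `F(s) = +∞`. -/
def subdiff (F : L1n n τ → EReal) (s : L1n n τ) : Set (Linfn n τ) :=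
  {a | F s ≠ ⊤ ∧ ∀ s' : L1n n τ, F s + (pairing (s' - s) a : EReal) ≤ F s'}

open Classical in
/-- The Kullback-Leibler divergence of families of functions. In the first case the integrand is
nonnegative (and `0 log (0 / 0) = 0` holds by the conventions of `Real.log` and division), so that
the integral is a Lebesgue integral with values in `[0, ∞]`. -/
def KL (τ : Measure T) (r s : Fin n → T → ℝ) : ℝ≥0∞ :=
  if ∀ k, ∀ᵐ t ∂τ, 0 ≤ r k t ∧ 0 ≤ s k t ∧ (s k t = 0 → r k t = 0) then
    ∑ k, ∫⁻ t, ENNReal.ofReal (Real.log (r k t / s k t) * r k t - r k t + s k t) ∂τ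
  else ∞

end Functionals

section Problem

variable {n : ℕ} {X Y : Type*} [MeasurableSpace X] [MeasurableSpace Y]
  {μ : Measure X} {ν : Measure Y} [IsProbabilityMeasure μ] [IsProbabilityMeasure ν]

/-- The first marginal `(P^X r)ₖ(x) = ∫ rₖ(x, y) dy`. -/
def projX (r : L1n n (μ.prod ν)) : L1n n μ := fun k =>
  Integrable.toL1 (fun x => ∫ y, r k (x, y) ∂ν) (L1.integrable_coeFn (r k)).integral_prod_left

/-- The second marginal `(P^Y r)ₖ(y) = ∫ rₖ(x, y) dx`. -/
def projY (r : L1n n (μ.prod ν)) : L1n n ν := fun k =>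
  Integrable.toL1 (fun y => ∫ x, r k (x, y) ∂μ) (L1.integrable_coeFn (r k)).integral_prod_right

/-- `u ⊕ v : (x, y) ↦ u(x) + v(y)`, componentwise. -/
def osum (u : Linfn n μ) (v : Linfn n ν) : Linfn n (μ.prod ν) := fun k =>
  Lp.compMeasurePreserving Prod.fst measurePreserving_fst (u k) +
    Lp.compMeasurePreserving Prod.snd measurePreserving_snd (v k)

/-- `ε KL(r | K)`. -/
def entropyTerm (K : Linfn n (μ.prod ν)) (ε : ℝ) (r : L1n n (μ.prod ν)) : EReal :=
  (ε : EReal) * (KL (μ.prod ν) (fun k => ⇑(r k)) (fun k => ⇑(K k)) : EReal)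

/-- The primal objective `F₁(P^X r) + F₂(P^Y r) + ε KL(r | K)`. -/
def primal (F₁ : L1n n μ → EReal) (F₂ : L1n n ν → EReal) (K : Linfn n (μ.prod ν)) (ε : ℝ)
    (r : L1n n (μ.prod ν)) : EReal :=
  F₁ (projX r) + F₂ (projY r) + entropyTerm K ε r

/-- The dual objective `- F₁*(-u) - F₂*(-v) - ε ⟨exp((u ⊕ v) / ε) - 1, K⟩`. -/
def dual (F₁ : L1n n μ → EReal) (F₂ : L1n n ν → EReal) (K : Linfn n (μ.prod ν)) (ε : ℝ)
    (p : Linfn n μ × Linfn n ν) : EReal :=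
  - conj F₁ (-p.1) - conj F₂ (-p.2) -
    ((ε * ∑ k, ∫ z, (Real.exp (osum p.1 p.2 k z / ε) - 1) * K k z ∂(μ.prod ν) : ℝ) : EReal)

/-- The objective of the Fenchel-Rockafellar dual of the primal problem, for the linear map
`r ↦ (P^X r, P^Y r)` with adjoint `(u, v) ↦ u ⊕ v`:
`- F₁*(-u) - F₂*(-v) - (ε KL(· | K))*(u ⊕ v)`. -/
def fenchelDual (F₁ : L1n n μ → EReal) (F₂ : L1n n ν → EReal) (K : Linfn n (μ.prod ν)) (ε : ℝ)
    (p : Linfn n μ × Linfn n ν) : EReal :=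
  - conj F₁ (-p.1) - conj F₂ (-p.2) - conj (entropyTerm K ε) (osum p.1 p.2)

end Problem

end EntropicDuality

end

/-! The argument is perturbation duality. Shift the arguments of `F₁` and `F₂` by `z = (z₁, z₂)`
(`perturbed`) and let `h(z)` be the infimum over `r`. A continuous affine minorant of the convex
function `h` is, through the duality of `L¹` with `L^∞`, a dual point whose objective is at least
the value of the minorant at `0` (`exists_le_dual`). By Hahn-Banach, the supremum of these values is
the value at `0` of the lower semicontinuous hull of `h`, once one affine minorant is known. Strong
duality therefore amounts to lower semicontinuity of `h` at `0`, and needs no constraint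
qualification.

This semicontinuity, together with attainment, comes from the entropy
(`exists_minimizer_or_minorants`). Take `r_j` almost optimal for `z_j → 0`, with values tending to
the hull. The entropy is uniformly convex in `L¹` norm on bounded sets, and its superlinear growth
bounds sublevel sets even after the affine minorants of `F₁` and `F₂` are subtracted. If two late
terms were far apart, their midpoint would have a value below what the hull permits near `0`. So
`(r_j)` is Cauchy, and joint lower semicontinuity makes its limit a minimizer; completeness takes
the place of weak compactness. The same midpoint argument gives uniqueness.

The gap between primal and dual values is a sum of three Fenchel-Young gaps, for `F₁`, `F₂` and the
entropy. It vanishes exactly when all three do, which gives the optimality conditions. The explicit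
dual and the exponential form of `r` come from the pointwise equality case of Fenchel-Young
(`mul_sub_eq_entDensity_iff`). -/

namespace EntropicDuality

open Filter Topology

/-! ### Separation of epigraphs and abstract perturbation duality. -/

section ConvexAnalysis

variable {Z : Type*} [NormedAddCommGroup Z] [NormedSpace ℝ Z]

/-- Separation of a point from the closure of a convex set of epigraph type, the vertical
component of the separating functional being made explicit. -/
theorem exists_separating_of_notMem_closure {S : Set (Z × ℝ)} (hS : Convex ℝ S)
    (hup : ∀ z t t', (z, t) ∈ S → t ≤ t' → (z, t') ∈ S) {z₀ : Z} {c : ℝ}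
    (h : (z₀, c) ∉ closure S) :
    ∃ (g : Z →L[ℝ] ℝ) (β : ℝ), 0 ≤ β ∧ ∃ α, g z₀ + β * c < α ∧
      ∀ z t, (z, t) ∈ S → α < g z + β * t := by
  rcases S.eq_empty_or_nonempty with rfl | ⟨⟨z₁, t₁⟩, h₁⟩
  · exact ⟨0, 0, le_rfl, 1, by simp, by simp⟩
  obtain ⟨f, α, hα, hf⟩ := geometric_hahn_banach_point_closed hS.closure isClosed_closure h
  have hsplit : ∀ z t, f (z, t) = f (z, 0) + f (0, 1) * t := by
    intro z t
    have : (z, t) = (z, (0 : ℝ)) + t • ((0 : Z), (1 : ℝ)) := by simp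
    rw [this, map_add, map_smul, smul_eq_mul, mul_comm]
  refine ⟨f.comp (ContinuousLinearMap.inl ℝ Z ℝ), f (0, 1), ?_, α, ?_, ?_⟩
  -- If the vertical component were negative, moving up along the ray above `(z₁, t₁)` would bring
  -- the functional down to `α`.
  · by_contra! hneg
    have key : ∀ t, t₁ ≤ t → α < f (z₁, 0) + f (0, 1) * t := fun t ht => by
      rw [← hsplit]; exact hf _ (subset_closure (hup _ _ _ h₁ ht))
    have h2 := key (max t₁ ((α - f (z₁, 0)) / f (0, 1))) (le_max_left _ _)
    have h3 := mul_le_mul_of_nonpos_left (le_max_right t₁ ((α - f (z₁, 0)) / f (0, 1))) hneg.le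
    rw [mul_div_cancel₀ _ hneg.ne] at h3
    linarith
  · simpa [← hsplit] using hα
  · intro z t hz
    simpa [← hsplit] using hf _ (subset_closure hz)

/-- A nonvertical minorant through a point below the epigraph, over a point of the domain. -/
theorem exists_minorant_of_mem {S : Set (Z × ℝ)} (hS : Convex ℝ S)
    (hup : ∀ z t t', (z, t) ∈ S → t ≤ t' → (z, t') ∈ S) {z₀ : Z} {c t₀ : ℝ}
    (h : (z₀, c) ∉ closure S) (h₀ : (z₀, t₀) ∈ S) :
    ∃ (f : Z →L[ℝ] ℝ) (C : ℝ), ∀ z t, (z, t) ∈ S → f z - C ≤ t := by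
  obtain ⟨g, β, hβ, α, hα, hg⟩ := exists_separating_of_notMem_closure hS hup h
  -- A vertical hyperplane would separate `z₀` strictly from itself, since `z₀` lies in the domain.
  have hβ' : 0 < β := by
    rcases hβ.eq_or_lt with rfl | hβ
    · have := hg _ _ h₀
      simp at this hα
      linarith
    · exact hβ
  refine ⟨-(β⁻¹ • g), -(β⁻¹ * α), fun z t hz => ?_⟩
  have h1 := mul_lt_mul_of_pos_left (hg _ _ hz) (inv_pos.2 hβ')
  rw [mul_add, inv_mul_cancel_left₀ hβ'.ne'] at h1
  simp
  linarith

/-- A minorant of an epigraph with prescribed value at the origin, provided that some affine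
minorant exists. -/
theorem exists_minorant_of_minorant {S : Set (Z × ℝ)} (hS : Convex ℝ S)
    (hup : ∀ z t t', (z, t) ∈ S → t ≤ t' → (z, t') ∈ S) {c : ℝ}
    (h : (0, c) ∉ closure S) (hmin : ∃ (f : Z →L[ℝ] ℝ) (C : ℝ), ∀ z t, (z, t) ∈ S → f z - C ≤ t) :
    ∃ f : Z →L[ℝ] ℝ, ∀ z t, (z, t) ∈ S → c + f z ≤ t := by
  obtain ⟨g, β, hβ, α, hα, hg⟩ := exists_separating_of_notMem_closure hS hup h
  rw [map_zero, zero_add] at hα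
  -- A vertical hyperplane carries no height. Subtracting a large multiple `N` of `g` from the known
  -- minorant tilts it: on `S` the minorant property survives because `α < g`, and at the origin the
  -- height gains `N * α`, where `α > 0`.
  rcases hβ.eq_or_lt with rfl | hβ
  · obtain ⟨f, C, hf⟩ := hmin
    simp only [zero_mul, add_zero] at hα hg
    obtain ⟨N, hN0, hN⟩ : ∃ N : ℝ, 0 ≤ N ∧ c + C ≤ N * α :=
      ⟨max 0 ((c + C) / α), le_max_left _ _, by
        rw [← div_le_iff₀ hα]; exact le_max_right _ _⟩
    refine ⟨f - N • g, fun z t hz => ?_⟩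
    have h1 := hf z t hz
    have h2 := mul_le_mul_of_nonneg_left (hg z t hz).le hN0
    simp
    linarith
  · refine ⟨-(β⁻¹ • g), fun z t hz => ?_⟩
    have h1 := mul_lt_mul_of_pos_left (hα.trans (hg _ _ hz)) (inv_pos.2 hβ)
    rw [mul_add, inv_mul_cancel_left₀ hβ.ne', inv_mul_cancel_left₀ hβ.ne'] at h1
    simp
    linarith

variable {E : Type*} [NormedAddCommGroup E] [NormedSpace ℝ E] [CompleteSpace E]

/-- Perturbation duality for a functional which is jointly convex and lower semicontinuous, and
uniformly convex in its first variable on sublevel sets: either the problem has a minimizer, with a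
value that is the supremum of the values at `0` of the affine minorants of the value function, or
these values are not bounded above. -/
theorem exists_minimizer_or_minorants (Φ : E → Z → EReal)
    (hconv : ∀ r r' z z' (t t' a b : ℝ), Φ r z ≤ t → Φ r' z' ≤ t' → 0 ≤ a → 0 ≤ b → a + b = 1 →
      Φ (a • r + b • r') (a • z + b • z') ≤ ((a * t + b * t' : ℝ) : EReal))
    (hlsc : LowerSemicontinuous fun p : E × Z => Φ p.1 p.2)
    (hmin : ∃ (f : Z →L[ℝ] ℝ) (C : ℝ), ∀ r z (t : ℝ), Φ r z ≤ t → f z - C ≤ t)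
    (hunif : ∀ M η : ℝ, 0 < η → ∃ δ > 0, ∀ r r' z z' (t t' : ℝ), ‖z‖ ≤ 1 → ‖z'‖ ≤ 1 →
      t ≤ M → t' ≤ M → Φ r z ≤ t → Φ r' z' ≤ t' → η ≤ ‖r - r'‖ →
      Φ ((1 / 2 : ℝ) • r + (1 / 2 : ℝ) • r') ((1 / 2 : ℝ) • z + (1 / 2 : ℝ) • z') ≤
        (((t + t') / 2 - δ : ℝ) : EReal)) :
    (∃ (r : E) (c₀ : ℝ), Φ r 0 ≤ c₀ ∧ ∀ c < c₀, ∃ f : Z →L[ℝ] ℝ,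
      ∀ r z (t : ℝ), Φ r z ≤ t → c + f z ≤ t) ∨
    ∀ c : ℝ, ∃ f : Z →L[ℝ] ℝ, ∀ r z (t : ℝ), Φ r z ≤ t → c + f z ≤ t := by
  set S : Set (Z × ℝ) := {p | ∃ r, Φ r p.1 ≤ (p.2 : EReal)} with hSdef
  have hS : Convex ℝ S := by
    rintro ⟨z, t⟩ ⟨r, hr⟩ ⟨z', t'⟩ ⟨r', hr'⟩ a b ha hb hab
    exact ⟨a • r + b • r', hconv r r' z z' t t' a b hr hr' ha hb hab⟩
  have hup : ∀ z t t', (z, t) ∈ S → t ≤ t' → (z, t') ∈ S := by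
    rintro z t t' ⟨r, hr⟩ htt
    exact ⟨r, hr.trans (by exact_mod_cast htt)⟩
  have hminS : ∃ (f : Z →L[ℝ] ℝ) (C : ℝ), ∀ z t, (z, t) ∈ S → f z - C ≤ t := by
    obtain ⟨f, C, hf⟩ := hmin
    exact ⟨f, C, fun z t ⟨r, hr⟩ => hf r z t hr⟩
  have hdual : ∀ c : ℝ, ((0 : Z), c) ∉ closure S →
      ∃ f : Z →L[ℝ] ℝ, ∀ r z (t : ℝ), Φ r z ≤ t → c + f z ≤ t := fun c hc => by
    obtain ⟨f, hf⟩ := exists_minorant_of_minorant hS hup hc hminS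
    exact ⟨f, fun r z t h => hf z t ⟨r, h⟩⟩
  -- `A` is the vertical slice at `0` of the closed epigraph; its infimum `c₀` is the value there of
  -- the lower semicontinuous hull of the value function.
  set A : Set ℝ := {c | ((0 : Z), c) ∈ closure S} with hA
  rcases A.eq_empty_or_nonempty with hAe | hAne
  · exact Or.inr fun c => hdual c fun hc => by
      have : c ∈ A := hc
      simp [hAe] at this
  left
  have hAclosed : IsClosed A := isClosed_closure.preimage (by fun_prop)
  have hAbdd : BddBelow A := by
    obtain ⟨f, C, hf⟩ := hminS
    refine ⟨-C, fun c hc => ?_⟩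
    have hcl : closure S ⊆ {p : Z × ℝ | f p.1 - C ≤ p.2} :=
      closure_minimal (fun p hp => hf p.1 p.2 hp)
        (isClosed_le (by fun_prop) (by fun_prop))
    have := hcl hc
    simp only [Set.mem_ofPred_eq, map_zero] at this
    linarith
  set c₀ := sInf A with hc₀
  have hc₀A : ((0 : Z), c₀) ∈ closure S := hAclosed.csInf_mem hAne hAbdd
  have hlow : ∀ c < c₀, ((0 : Z), c) ∉ closure S := fun c hc h =>
    (csInf_le hAbdd (show c ∈ A from h)).not_gt hc
  -- near the origin, the value function is not much smaller than `c₀`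
  have hnear : ∀ η > 0, ∃ δ > 0, ∀ r z (t : ℝ), ‖z‖ < δ → Φ r z ≤ t → c₀ - η ≤ t := by
    intro η hη
    by_contra! hcon
    refine hlow (c₀ - η) (by linarith) (Metric.mem_closure_iff.2 fun δ hδ => ?_)
    obtain ⟨r, z, t, hz, hr, ht⟩ := hcon δ hδ
    refine ⟨(z, c₀ - η), hup _ _ _ ⟨r, hr⟩ ht.le, ?_⟩
    simpa [Prod.dist_eq, dist_eq_norm, hδ] using hz
  have happrox : ∀ δ > 0, ∃ r z, ‖z‖ < δ ∧ Φ r z ≤ ((c₀ + δ : ℝ) : EReal) := by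
    intro δ hδ
    obtain ⟨⟨z, t⟩, ⟨r, hr⟩, hd⟩ := Metric.mem_closure_iff.1 hc₀A δ hδ
    rw [Prod.dist_eq, max_lt_iff] at hd
    refine ⟨r, z, by simpa [dist_eq_norm] using hd.1, hr.trans ?_⟩
    have := (abs_lt.1 (by simpa [Real.dist_eq] using hd.2)).1
    exact_mod_cast (by linarith : t ≤ c₀ + δ)
  choose R W hW hR using fun j : ℕ => happrox (1 / ((j : ℝ) + 1)) Nat.one_div_pos_of_nat
  have hlim : Tendsto (fun j : ℕ => 1 / ((j : ℝ) + 1)) atTop (𝓝 0) :=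
    tendsto_one_div_add_atTop_nhds_zero_nat
  -- Two late terms at distance at least `η` would give the midpoint a value at most `c₀ + δ / 3 -
  -- δ`, below the bound `c₀ - δ / 3` valid near `z = 0`.
  have hcauchy : CauchySeq R := by
    refine Metric.cauchySeq_iff.2 fun η hη => ?_
    obtain ⟨δ, hδ, hun⟩ := hunif (c₀ + 1) η hη
    obtain ⟨δ', hδ', hne⟩ := hnear (δ / 3) (by positivity)
    obtain ⟨N, hN⟩ := (hlim.eventually (gt_mem_nhds (show (0 : ℝ) < min (min δ' 1) (δ / 3) by
      positivity))).exists_forall_of_atTop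
    refine ⟨N, fun i hi j hj => ?_⟩
    by_contra! hcon
    rw [dist_eq_norm] at hcon
    have hi' := hN i hi
    have hj' := hN j hj
    simp only [lt_min_iff] at hi' hj'
    have h1 := hun (R i) (R j) (W i) (W j) _ _ ((hW i).le.trans hi'.1.2.le)
      ((hW j).le.trans hj'.1.2.le) (by linarith) (by linarith) (hR i) (hR j) hcon
    have hnorm : ‖(1 / 2 : ℝ) • W i + (1 / 2 : ℝ) • W j‖ < δ' := by
      refine (norm_add_le _ _).trans_lt ?_
      rw [norm_smul, norm_smul]
      have := (hW i).trans hi'.1.1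
      have := (hW j).trans hj'.1.1
      norm_num
      linarith
    have h2 := hne _ _ _ hnorm h1
    linarith
  obtain ⟨r, hr⟩ := cauchySeq_tendsto_of_complete hcauchy
  refine ⟨r, c₀, ?_, fun c hc => hdual c (hlow c hc)⟩
  have hWlim : Tendsto W atTop (𝓝 0) :=
    squeeze_zero_norm (fun j => (hW j).le) hlim
  have hprod : Tendsto (fun j => (R j, W j)) atTop (𝓝 (r, 0)) := hr.prodMk_nhds hWlim
  refine EReal.le_of_forall_lt_iff_le.1 fun y hy => ?_
  have hy' : c₀ < y := by exact_mod_cast hy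
  have hcl := hlsc.isClosed_preimage (y : EReal)
  refine hcl.mem_of_tendsto hprod ?_
  filter_upwards [hlim.eventually (gt_mem_nhds (sub_pos.2 hy'))] with j hj
  refine (hR j).trans ?_
  exact_mod_cast (by linarith : c₀ + 1 / ((j : ℝ) + 1) ≤ y)

end ConvexAnalysis

/-! ### The dual of `L¹` is `L^∞` on a finite measure space. -/

section LpDuality

variable {T : Type*} [MeasurableSpace T] {τ : Measure T}

/-- The pairing of a class in `L^∞` with the classes in `L¹`, as a continuous functional. -/
noncomputable def linftyFunctional (a : Lp ℝ ∞ τ) : Lp ℝ 1 τ →L[ℝ] ℝ :=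
  ((ContinuousLinearMap.mul ℝ ℝ).lpPairing τ 1 ∞).flip a

theorem linftyFunctional_apply (a : Lp ℝ ∞ τ) (s : Lp ℝ 1 τ) :
    linftyFunctional a s = ∫ t, s t * a t ∂τ := by
  simp [linftyFunctional, ContinuousLinearMap.lpPairing_eq_integral]

theorem norm_indicatorConstLp_one [IsFiniteMeasure τ] (s : Set T) (hs : MeasurableSet s) :
    ‖indicatorConstLp 1 hs (measure_ne_top τ s) (1 : ℝ)‖ = τ.real s := by
  rw [norm_indicatorConstLp one_ne_zero ENNReal.one_ne_top]
  simp

/-- On a finite measure space, every continuous functional on `L¹` is given by a class in `L^∞`. -/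
theorem exists_eq_linftyFunctional [IsFiniteMeasure τ] (f : Lp ℝ 1 τ →L[ℝ] ℝ) :
    ∃ a : Lp ℝ ∞ τ, f = linftyFunctional a := by
  let one : Lp ℝ 2 τ := (memLp_const (1 : ℝ)).toLp _
  -- The inclusion of `L²` in `L¹`, realized as Hölder multiplication by the constant `1`. Pulling
  -- `f` back along it lets the Riesz theorem in `L²` supply the density `g`.
  let J : Lp ℝ 2 τ →L[ℝ] Lp ℝ 1 τ := (ContinuousLinearMap.mul ℝ ℝ).holderL τ 2 2 1 one
  have hJ : ∀ g : Lp ℝ 2 τ, J g =ᵐ[τ] g := fun g => by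
    have h1 : J g =ᵐ[τ] fun x => (ContinuousLinearMap.mul ℝ ℝ) (one x) (g x) :=
      (ContinuousLinearMap.mul ℝ ℝ).coeFn_holder one g
    filter_upwards [h1, MemLp.coeFn_toLp (memLp_const (μ := τ) (p := 2) (1 : ℝ))] with x hx hx1
    rw [hx]
    simp only [one, hx1]
    simp
  let g : Lp ℝ 2 τ := (InnerProductSpace.toDual ℝ (Lp ℝ 2 τ)).symm (f.comp J)
  have hgint : Integrable g τ := (Lp.memLp g).integrable (by norm_num)
  have hg : ∀ s (hs : MeasurableSet s),
      f (indicatorConstLp 1 hs (measure_ne_top τ s) (1 : ℝ)) = ∫ x in s, g x ∂τ := by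
    intro s hs
    have h1 : J (indicatorConstLp 2 hs (measure_ne_top τ s) (1 : ℝ)) =
        indicatorConstLp 1 hs (measure_ne_top τ s) (1 : ℝ) := by
      apply Lp.ext
      exact (hJ _).trans (indicatorConstLp_coeFn.trans indicatorConstLp_coeFn.symm)
    rw [← h1, ← L2.inner_indicatorConstLp_one (𝕜 := ℝ) hs (measure_ne_top τ s) g, real_inner_comm]
    simp [g]
  -- Testing on indicators bounds the averages of `g` by `‖f‖`, which forces `|g| ≤ ‖f‖` almost
  -- everywhere.
  have hbound : ∀ s, MeasurableSet s → |∫ x in s, g x ∂τ| ≤ ‖f‖ * τ.real s := by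
    intro s hs
    rw [← hg s hs, ← norm_indicatorConstLp_one s hs]
    exact f.le_opNorm _
  have hle : ∀ᵐ x ∂τ, g x ≤ ‖f‖ :=
    ae_le_of_forall_setIntegral_le hgint (integrable_const _) fun s hs _ => by
      have := (abs_le.1 (hbound s hs)).2
      simpa [mul_comm] using this
  have hge : ∀ᵐ x ∂τ, -‖f‖ ≤ g x :=
    ae_le_of_forall_setIntegral_le (integrable_const _) hgint fun s hs _ => by
      have := (abs_le.1 (hbound s hs)).1
      simpa [mul_comm] using this
  have hmem : MemLp g ∞ τ := memLp_top_of_bound hgint.1 ‖f‖ (by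
    filter_upwards [hle, hge] with x h1 h2 using abs_le.2 ⟨h2, h1⟩)
  refine ⟨hmem.toLp _, ContinuousLinearMap.ext fun s => ?_⟩
  induction s using Lp.induction ENNReal.one_ne_top with
  | indicatorConst c hs hμs =>
    rename_i s
    have h1 : (Lp.simpleFunc.indicatorConst 1 hs hμs.ne c : Lp ℝ 1 τ) =
        c • indicatorConstLp 1 hs (measure_ne_top τ s) (1 : ℝ) := by
      rw [Lp.simpleFunc.coe_indicatorConst]
      apply Lp.ext
      filter_upwards [indicatorConstLp_coeFn (p := 1) (hs := hs) (hμs := measure_ne_top τ s)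
        (c := c), indicatorConstLp_coeFn (p := 1) (hs := hs) (hμs := measure_ne_top τ s)
        (c := (1 : ℝ)), Lp.coeFn_smul c (indicatorConstLp 1 hs (measure_ne_top τ s) (1 : ℝ))]
        with x h1 h2 h3
      rw [h3, Pi.smul_apply, h1, h2]
      by_cases hxs : x ∈ s <;> simp [hxs]
    rw [h1, map_smul, map_smul, hg, linftyFunctional_apply]
    congr 1
    rw [← integral_indicator hs]
    refine integral_congr_ae ?_
    filter_upwards [indicatorConstLp_coeFn (p := 1) (hs := hs) (hμs := measure_ne_top τ s)
      (c := (1 : ℝ)), hmem.coeFn_toLp] with x hx hx'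
    rw [hx, hx']
    by_cases hxs : x ∈ s <;> simp [hxs]
  | add hf hg _ h1 h2 => rw [map_add, map_add, h1, h2]
  | isClosed => exact isClosed_eq f.continuous (linftyFunctional _).continuous

theorem integrable_mul_Lp_top (s : Lp ℝ 1 τ) (a : Lp ℝ ∞ τ) : Integrable (fun t => s t * a t) τ :=
  (ContinuousLinearMap.mul ℝ ℝ).memLp_of_bilin 1 (Lp.memLp s) (Lp.memLp a)
    |> memLp_one_iff_integrable.1

variable {n : ℕ}

theorem pairing_eq_sum (s : L1n n τ) (a : Linfn n τ) :
    pairing s a = ∑ k, linftyFunctional (a k) (s k) := by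
  simp [pairing, linftyFunctional_apply]

theorem pairing_sub_left (s s' : L1n n τ) (a : Linfn n τ) :
    pairing (s - s') a = pairing s a - pairing s' a := by
  simp [pairing_eq_sum]

theorem pairing_neg_right (s : L1n n τ) (a : Linfn n τ) : pairing s (-a) = -pairing s a := by
  simp only [pairing_eq_sum, linftyFunctional, Pi.neg_apply, map_neg, neg_apply,
    Finset.sum_neg_distrib]

/-- On a finite measure space, every continuous functional on `L¹(T)ⁿ` is a pairing with an element
of `L^∞(T)ⁿ`. -/
theorem exists_eq_pairing [IsFiniteMeasure τ] (f : L1n n τ →L[ℝ] ℝ) :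
    ∃ a : Linfn n τ, ∀ s, f s = pairing s a := by
  choose a ha using fun k => exists_eq_linftyFunctional
    (f.comp (ContinuousLinearMap.single ℝ (fun _ : Fin n => Lp ℝ 1 τ) k))
  refine ⟨a, fun s => ?_⟩
  rw [pairing_eq_sum, ← ContinuousLinearMap.sum_comp_single]
  refine Finset.sum_congr rfl fun k _ => ?_
  rw [← ha]

end LpDuality

/-! ### The scalar entropy integrand: Fenchel-Young and uniform convexity. -/

section Pointwise

/-- The integrand of the Kullback-Leibler divergence. -/
noncomputable def entDensity (x y : ℝ) : ℝ := Real.log (x / y) * x - x + y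

/-- The pairs of values at which the Kullback-Leibler integrand is finite. -/
def EntAdmissible (x y : ℝ) : Prop := 0 ≤ x ∧ 0 ≤ y ∧ (y = 0 → x = 0)

theorem entDensity_eq {x y : ℝ} (hy : 0 < y) :
    entDensity x y = x * Real.log x - x * Real.log y - x + y := by
  rcases eq_or_ne x 0 with rfl | hx
  · simp [entDensity]
  · rw [entDensity, Real.log_div hx hy.ne']
    ring

theorem continuous_entDensity (y : ℝ) : Continuous fun x => entDensity x y := by
  -- At `y = 0` the conventions `x / 0 = 0` and `log 0 = 0` reduce the density to `-x`.
  rcases eq_or_ne y 0 with rfl | hy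
  · simp only [entDensity, div_zero, Real.log_zero, zero_mul]
    fun_prop
  · have : (fun x => entDensity x y) = fun x => y * ((x / y) * Real.log (x / y)) - x + y := by
      funext x
      rw [entDensity]
      field_simp
    rw [this]
    have := Real.continuous_mul_log.comp (continuous_id.div_const y)
    simp only [Function.comp_def, id] at this
    fun_prop

/-- The Fenchel-Young inequality for the Kullback-Leibler integrand. -/
theorem mul_sub_le_entDensity {x y : ℝ} (h : EntAdmissible x y) (a : ℝ) :
    x * a - (Real.exp a - 1) * y ≤ entDensity x y := by
  obtain ⟨hx, hy, h0⟩ := h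
  rcases hy.eq_or_lt with rfl | hy
  · simp [h0 rfl, entDensity]
  rw [entDensity_eq hy]
  rcases hx.eq_or_lt with rfl | hx
  · have := mul_pos (Real.exp_pos a) hy
    simp
    linarith
  -- The whole inequality is `log q ≤ q - 1` at `q = y * exp a / x`, multiplied by `x`; equality
  -- holds only for `q = 1`.
  have h1 := Real.log_le_sub_one_of_pos (x := y * Real.exp a / x) (by positivity)
  rw [Real.log_div (by positivity) hx.ne', Real.log_mul hy.ne' (Real.exp_pos a).ne',
    Real.log_exp] at h1
  have h2 := mul_le_mul_of_nonneg_left h1 hx.le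
  have h3 : x * (y * Real.exp a / x - 1) = y * Real.exp a - x := by field_simp
  linarith

/-- The equality case of the Fenchel-Young inequality for the Kullback-Leibler integrand. -/
theorem mul_sub_eq_entDensity_iff {x y : ℝ} (h : EntAdmissible x y) (a : ℝ) :
    x * a - (Real.exp a - 1) * y = entDensity x y ↔ x = y * Real.exp a := by
  obtain ⟨hx, hy, h0⟩ := h
  rcases hy.eq_or_lt with rfl | hy
  · simp [h0 rfl, entDensity]
  rw [entDensity_eq hy]
  have hpos := mul_pos hy (Real.exp_pos a)
  rcases hx.eq_or_lt with rfl | hx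
  · constructor <;> intro h <;> simp at h <;> linarith
  constructor
  · intro heq
    by_contra hne
    have hq : y * Real.exp a / x ≠ 1 := fun h => hne (by field_simp at h; linarith)
    have h1 := Real.log_lt_sub_one_of_pos (x := y * Real.exp a / x) (by positivity) hq
    rw [Real.log_div (by positivity) hx.ne', Real.log_mul hy.ne' (Real.exp_pos a).ne',
      Real.log_exp] at h1
    have h2 := mul_lt_mul_of_pos_left h1 hx
    have h3 : x * (y * Real.exp a / x - 1) = y * Real.exp a - x := by field_simp
    linarith
  · intro heq
    have : Real.log x = Real.log y + a := by
      rw [heq, Real.log_mul hy.ne' (Real.exp_pos a).ne', Real.log_exp]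
    rw [this]
    linear_combination heq

theorem entDensity_nonneg {x y : ℝ} (h : EntAdmissible x y) : 0 ≤ entDensity x y := by
  simpa using mul_sub_le_entDensity h 0

theorem EntAdmissible.combo {x x' y a b : ℝ} (h : EntAdmissible x y) (h' : EntAdmissible x' y)
    (ha : 0 ≤ a) (hb : 0 ≤ b) : EntAdmissible (a * x + b * x') y :=
  ⟨by have := h.1; have := h'.1; positivity, h.2.1, fun h0 => by simp [h.2.2 h0, h'.2.2 h0]⟩

theorem entDensity_combo_le {x x' y a b : ℝ} (h : EntAdmissible x y) (h' : EntAdmissible x' y)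
    (ha : 0 ≤ a) (hb : 0 ≤ b) (hab : a + b = 1) :
    entDensity (a * x + b * x') y ≤ a * entDensity x y + b * entDensity x' y := by
  rcases h.2.1.eq_or_lt with hy | hy
  · simp [← hy, h.2.2 hy.symm, h'.2.2 hy.symm, entDensity]
  have h1 := Real.convexOn_mul_log.2 (Set.mem_Ici.2 h.1) (Set.mem_Ici.2 h'.1) ha hb hab
  simp only [smul_eq_mul] at h1
  rw [entDensity_eq hy, entDensity_eq hy, entDensity_eq hy]
  have : y = (a + b) * y := by rw [hab, one_mul]
  linarith

/-- The divergence dominates the squared Hellinger distance: apply `log q ≤ q - 1` at `q = √m / √x`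
and multiply by `2 * x`. -/
theorem sq_sqrt_sub_sqrt_le_entDensity {x m : ℝ} (hx : 0 ≤ x) (hm : 0 < m) :
    (√x - √m) ^ 2 ≤ entDensity x m := by
  rcases hx.eq_or_lt with rfl | hx
  · simp [entDensity, hm.le]
  have hs := Real.sqrt_pos.2 hx
  have hs' := Real.sqrt_pos.2 hm
  have h1 := Real.log_le_sub_one_of_pos (x := √m / √x) (by positivity)
  rw [Real.log_div hs'.ne' hs.ne', Real.log_sqrt hm.le, Real.log_sqrt hx.le] at h1
  rw [entDensity_eq hm]
  have h2 := mul_le_mul_of_nonneg_left h1 hx.le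
  have h3 : x * (√m / √x - 1) = √x * √m - x := by
    have := Real.mul_self_sqrt hx.le
    field_simp
    nlinarith
  have h4 := Real.mul_self_sqrt hx.le
  have h5 := Real.mul_self_sqrt hm.le
  nlinarith

/-- Uniform convexity of the Kullback-Leibler integrand. -/
theorem abs_sub_le_entDensity {x x' y δ : ℝ} (h : EntAdmissible x y) (h' : EntAdmissible x' y)
    (hδ : 0 < δ) :
    |x - x'| ≤ δ * (x + x') + δ⁻¹ *
      (entDensity x y + entDensity x' y - 2 * entDensity (1 / 2 * x + 1 / 2 * x') y) := by
  rcases h.2.1.eq_or_lt with hy | hy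
  · simp [← hy, h.2.2 hy.symm, h'.2.2 hy.symm, entDensity]
  have hx := h.1
  have hx' := h'.1
  set m := 1 / 2 * x + 1 / 2 * x' with hm
  rcases (show 0 ≤ m by positivity).eq_or_lt with hm0 | hm0
  · have e1 : x = 0 := by linarith
    have e2 : x' = 0 := by linarith
    rw [← hm0, e1, e2]
    exact le_of_eq (by rw [sub_self, abs_zero]; ring)
  -- A parallelogram identity: the midpoint convexity gap is the sum of the divergences from the
  -- midpoint, and `y` drops out.
  have key : entDensity x y + entDensity x' y - 2 * entDensity m y =
      entDensity x m + entDensity x' m := by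
    simp only [entDensity_eq hy, entDensity_eq hm0]
    rw [show x' = 2 * m - x by linarith]
    ring
  rw [key]
  -- Factor `w - m = (√w - √m) * (√w + √m)` and use Young's inequality with weight `δ`. The first
  -- factor is controlled by the divergence, the second by the mass.
  have aux : ∀ w, 0 ≤ w → |w - m| ≤ δ * ((w + m) / 2) + δ⁻¹ * entDensity w m := by
    intro w hw
    have h1 := sq_sqrt_sub_sqrt_le_entDensity hw hm0
    have h2 := Real.mul_self_sqrt hw
    have h3 := Real.mul_self_sqrt hm0.le
    have hwm : w - m = (√w - √m) * (√w + √m) := by rw [← h2, ← h3]; simp; ring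
    set p := |√w - √m| with hp
    set q := √w + √m with hq
    have hq0 : 0 ≤ q := by positivity
    have h4 : |w - m| = p * q := by rw [hwm, abs_mul, abs_of_nonneg hq0]
    have h5 : p ^ 2 ≤ entDensity w m := by rw [hp, sq_abs]; exact h1
    have h6 : q ^ 2 ≤ 2 * (w + m) := by nlinarith [sq_nonneg (√w - √m)]
    have h7 : p * q ≤ δ * (q ^ 2 / 4) + δ⁻¹ * p ^ 2 := by
      have : δ * (q ^ 2 / 4) + δ⁻¹ * p ^ 2 - p * q = δ⁻¹ * (δ * q / 2 - p) ^ 2 := by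
        field_simp
        ring
      have : 0 ≤ δ⁻¹ * (δ * q / 2 - p) ^ 2 := by positivity
      linarith
    rw [h4]
    refine h7.trans (add_le_add ?_ ?_)
    · exact mul_le_mul_of_nonneg_left (by linarith) hδ.le
    · gcongr
  have a1 := aux x hx
  have a2 := aux x' hx'
  have h8 : |x - x'| ≤ |x - m| + |x' - m| := by
    rw [abs_sub_comm x' m]; exact abs_sub_le _ _ _
  have h9 : δ * ((x + m) / 2) + δ * ((x' + m) / 2) = δ * (x + x') := by rw [hm]; ring
  linarith

end Pointwise

/-! ### The integrated divergence: semicontinuity, growth, uniform convexity and conjugacy. -/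

section Divergence

variable {T : Type*} [MeasurableSpace T] {τ : Measure T}

open Classical in
/-- The Kullback-Leibler divergence of two functions. -/
noncomputable def scalarKL (τ : Measure T) (f g : T → ℝ) : ℝ≥0∞ :=
  if ∀ᵐ t ∂τ, EntAdmissible (f t) (g t) then
    ∫⁻ t, ENNReal.ofReal (entDensity (f t) (g t)) ∂τ
  else ∞

theorem KL_eq_sum {n : ℕ} (r s : Fin n → T → ℝ) : KL τ r s = ∑ k, scalarKL τ (r k) (s k) := by
  unfold KL
  split_ifs with h
  · exact Finset.sum_congr rfl fun k _ => by
      rw [scalarKL, if_pos (show ∀ᵐ t ∂τ, EntAdmissible (r k t) (s k t) from h k)]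
      rfl
  · obtain ⟨k, hk⟩ := not_forall.1 h
    refine (ENNReal.sum_eq_top.2 ⟨k, Finset.mem_univ _, ?_⟩).symm
    rw [scalarKL, if_neg]
    exact hk

theorem aemeasurable_entDensity {f g : T → ℝ} (hf : AEMeasurable f τ) (hg : AEMeasurable g τ) :
    AEMeasurable (fun t => entDensity (f t) (g t)) τ :=
  ((Real.measurable_log.comp_aemeasurable (hf.div hg)).mul hf |>.sub hf).add hg

/-- Along an almost everywhere convergent subsequence, Fatou's lemma applies because the density is
continuous in its first argument; admissibility is a closed condition on that argument. -/
theorem lowerSemicontinuous_scalarKL {g : T → ℝ} (hg : AEMeasurable g τ) :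
    LowerSemicontinuous fun f : Lp ℝ 1 τ => scalarKL τ f g := by
  refine lowerSemicontinuous_iff_isClosed_preimage.2 fun c => IsSeqClosed.isClosed ?_
  intro F f hF hlim
  rcases eq_or_ne c ∞ with rfl | hc
  · simp
  obtain ⟨φ, -, hφ⟩ := (tendstoInMeasure_of_tendsto_Lp hlim).exists_seq_tendsto_ae
  have hadm : ∀ j, ∀ᵐ t ∂τ, EntAdmissible (F j t) (g t) := fun j => by
    by_contra hcon
    have := hF j
    simp [scalarKL, hcon, hc] at this
  have hle : ∀ j, ∫⁻ t, ENNReal.ofReal (entDensity (F j t) (g t)) ∂τ ≤ c := fun j => by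
    have := hF j
    simpa [scalarKL, hadm j] using this
  have hadm' : ∀ᵐ t ∂τ, EntAdmissible (f t) (g t) := by
    filter_upwards [hφ, ae_all_iff.2 hadm] with t ht hadm
    refine ⟨ge_of_tendsto' ht fun j => (hadm _).1, (hadm 0).2.1, fun h0 => ?_⟩
    refine tendsto_nhds_unique ht ?_
    simp [fun j => (hadm j).2.2 h0]
  rw [Set.mem_preimage, Set.mem_Iic, scalarKL, if_pos hadm']
  calc ∫⁻ t, ENNReal.ofReal (entDensity (f t) (g t)) ∂τ
      = ∫⁻ t, liminf (fun j => ENNReal.ofReal (entDensity (F (φ j) t) (g t))) atTop ∂τ := by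
        refine lintegral_congr_ae ?_
        filter_upwards [hφ] with t ht
        exact (((ENNReal.continuous_ofReal.comp (continuous_entDensity (g t))).tendsto _).comp
          ht).liminf_eq.symm
    _ ≤ liminf (fun j => ∫⁻ t, ENNReal.ofReal (entDensity (F (φ j) t) (g t)) ∂τ) atTop :=
        lintegral_liminf_le' fun j => (aemeasurable_entDensity
          (Lp.aestronglyMeasurable _).aemeasurable hg).ennreal_ofReal
    _ ≤ c := liminf_le_of_frequently_le' (Frequently.of_forall fun j => hle _)

variable {n : ℕ}

/-- The families of functions whose Kullback-Leibler divergence with respect to `K` is finite. -/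
def FiniteEntropy (r : L1n n τ) (K : Linfn n τ) : Prop :=
  ∀ k, (∀ᵐ t ∂τ, EntAdmissible (r k t) (K k t)) ∧
    Integrable (fun t => entDensity (r k t) (K k t)) τ

/-- The Kullback-Leibler divergence as a real number. -/
noncomputable def entropy (r : L1n n τ) (K : Linfn n τ) : ℝ :=
  ∑ k, ∫ t, entDensity (r k t) (K k t) ∂τ

theorem FiniteEntropy.KL_eq {r : L1n n τ} {K : Linfn n τ} (h : FiniteEntropy r K) :
    KL τ (fun k => ⇑(r k)) (fun k => ⇑(K k)) = ENNReal.ofReal (entropy r K) := by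
  rw [KL_eq_sum, entropy, ENNReal.ofReal_sum_of_nonneg]
  · refine Finset.sum_congr rfl fun k _ => ?_
    rw [scalarKL, if_pos (h k).1, ofReal_integral_eq_lintegral_ofReal (h k).2]
    filter_upwards [(h k).1] with t ht using entDensity_nonneg ht
  · exact fun k _ => integral_nonneg_of_ae (by
      filter_upwards [(h k).1] with t ht using entDensity_nonneg ht)

theorem FiniteEntropy.entropy_nonneg {r : L1n n τ} {K : Linfn n τ} (h : FiniteEntropy r K) :
    0 ≤ entropy r K :=
  Finset.sum_nonneg fun k _ => integral_nonneg_of_ae (by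
    filter_upwards [(h k).1] with t ht using entDensity_nonneg ht)

theorem finiteEntropy_of_KL_ne_top {r : L1n n τ} {K : Linfn n τ}
    (h : KL τ (fun k => ⇑(r k)) (fun k => ⇑(K k)) ≠ ∞) : FiniteEntropy r K := by
  rw [KL_eq_sum, ENNReal.sum_ne_top] at h
  intro k
  have hk := h k (Finset.mem_univ _)
  have hadm : ∀ᵐ t ∂τ, EntAdmissible (r k t) (K k t) := by
    by_contra hcon
    simp [scalarKL, hcon] at hk
  rw [scalarKL, if_pos hadm] at hk
  have hmeas := aemeasurable_entDensity (Lp.aestronglyMeasurable (r k)).aemeasurable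
    (Lp.aestronglyMeasurable (K k)).aemeasurable
  refine ⟨hadm, hmeas.aestronglyMeasurable, ?_⟩
  rw [hasFiniteIntegral_iff_ofReal]
  · exact hk.lt_top
  · filter_upwards [hadm] with t ht using entDensity_nonneg ht

theorem lowerSemicontinuous_KL (K : Linfn n τ) :
    LowerSemicontinuous fun r : L1n n τ => KL τ (fun k => ⇑(r k)) (fun k => ⇑(K k)) := by
  simp only [KL_eq_sum]
  exact lowerSemicontinuous_sum fun k _ =>
    (lowerSemicontinuous_scalarKL (Lp.aestronglyMeasurable (K k)).aemeasurable).comp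
      (continuous_apply k)

theorem coeFn_combo (f g : Lp ℝ 1 τ) (a b : ℝ) :
    ⇑(a • f + b • g) =ᵐ[τ] fun t => a * f t + b * g t := by
  filter_upwards [Lp.coeFn_add (a • f) (b • g), Lp.coeFn_smul a f, Lp.coeFn_smul b g]
    with t h1 h2 h3
  rw [h1, Pi.add_apply, h2, h3]
  simp

theorem FiniteEntropy.combo {r r' : L1n n τ} {K : Linfn n τ} (h : FiniteEntropy r K)
    (h' : FiniteEntropy r' K) {a b : ℝ} (ha : 0 ≤ a) (hb : 0 ≤ b) (hab : a + b = 1) :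
    FiniteEntropy (a • r + b • r') K := by
  intro k
  have hadm : ∀ᵐ t ∂τ, EntAdmissible ((a • r + b • r') k t) (K k t) := by
    filter_upwards [(h k).1, (h' k).1, coeFn_combo (r k) (r' k) a b] with t h1 h2 h3
    simp only [Pi.add_apply, Pi.smul_apply, h3]
    exact h1.combo h2 ha hb
  refine ⟨hadm, Integrable.mono' (((h k).2.const_mul a).add ((h' k).2.const_mul b))
    (aemeasurable_entDensity (Lp.aestronglyMeasurable _).aemeasurable
      (Lp.aestronglyMeasurable _).aemeasurable).aestronglyMeasurable ?_⟩
  filter_upwards [(h k).1, (h' k).1, hadm, coeFn_combo (r k) (r' k) a b] with t h1 h2 h3 h4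
  rw [Real.norm_eq_abs, abs_of_nonneg (entDensity_nonneg h3)]
  simp only [Pi.add_apply, Pi.smul_apply, h4]
  exact entDensity_combo_le h1 h2 ha hb hab

theorem entropy_combo_le {r r' : L1n n τ} {K : Linfn n τ} (h : FiniteEntropy r K)
    (h' : FiniteEntropy r' K) {a b : ℝ} (ha : 0 ≤ a) (hb : 0 ≤ b) (hab : a + b = 1) :
    entropy (a • r + b • r') K ≤ a * entropy r K + b * entropy r' K := by
  simp only [entropy, Finset.mul_sum]
  rw [← Finset.sum_add_distrib]
  refine Finset.sum_le_sum fun k _ => ?_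
  rw [← integral_const_mul, ← integral_const_mul,
    ← integral_add ((h k).2.const_mul a) ((h' k).2.const_mul b)]
  refine integral_mono_ae ((h.combo h' ha hb hab) k).2
    (((h k).2.const_mul a).add ((h' k).2.const_mul b)) ?_
  filter_upwards [(h k).1, (h' k).1, coeFn_combo (r k) (r' k) a b] with t h1 h2 h4
  simp only [Pi.add_apply, Pi.smul_apply, h4]
  exact entDensity_combo_le h1 h2 ha hb hab

theorem FiniteEntropy.norm_eq {r : L1n n τ} {K : Linfn n τ} (h : FiniteEntropy r K) (k : Fin n) :
    ‖r k‖ = ∫ t, r k t ∂τ := by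
  rw [L1.norm_eq_integral_norm]
  refine integral_congr_ae ?_
  filter_upwards [(h k).1] with t ht
  exact abs_of_nonneg ht.1

theorem integrable_Lp_top [IsFiniteMeasure τ] (a : Lp ℝ ∞ τ) : Integrable a τ :=
  (Lp.memLp a).integrable (by simp)

/-- The Kullback-Leibler divergence grows superlinearly. -/
theorem mul_norm_le_entropy [IsFiniteMeasure τ] {r : L1n n τ} {K : Linfn n τ}
    (h : FiniteEntropy r K) (A : ℝ) :
    A * ∑ k, ‖r k‖ ≤ entropy r K + (Real.exp A - 1) * ∑ k, ∫ t, K k t ∂τ := by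
  simp only [entropy, Finset.mul_sum]
  rw [← Finset.sum_add_distrib]
  refine Finset.sum_le_sum fun k _ => ?_
  have hK := (integrable_Lp_top (K k)).const_mul (Real.exp A - 1)
  rw [h.norm_eq, ← integral_const_mul, ← integral_const_mul, ← integral_add (h k).2 hK]
  refine integral_mono_ae ((L1.integrable_coeFn (r k)).const_mul A) ((h k).2.add hK) ?_
  filter_upwards [(h k).1] with t ht
  -- Superlinearity is Fenchel-Young with the constant slope `A`, which is arbitrary.
  have := mul_sub_le_entDensity ht A
  linarith

/-- Uniform convexity of the Kullback-Leibler divergence with respect to the norm of `L¹`. -/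
theorem sum_norm_sub_le_entropy {r r' : L1n n τ} {K : Linfn n τ}
    (h : FiniteEntropy r K) (h' : FiniteEntropy r' K) {δ : ℝ} (hδ : 0 < δ) :
    ∑ k, ‖r k - r' k‖ ≤ δ * (∑ k, ‖r k‖ + ∑ k, ‖r' k‖) + δ⁻¹ * (entropy r K + entropy r' K -
      2 * entropy ((1 / 2 : ℝ) • r + (1 / 2 : ℝ) • r') K) := by
  have hm := h.combo h' (a := 1 / 2) (b := 1 / 2) (by norm_num) (by norm_num) (by norm_num)
  simp only [entropy]
  rw [Finset.mul_sum _ _ (2 : ℝ), ← Finset.sum_add_distrib, ← Finset.sum_add_distrib,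
    ← Finset.sum_sub_distrib, Finset.mul_sum, Finset.mul_sum, ← Finset.sum_add_distrib]
  refine Finset.sum_le_sum fun k _ => ?_
  have i1 := L1.integrable_coeFn (r k)
  have i2 := L1.integrable_coeFn (r' k)
  have i5 : Integrable (fun t => r k t + r' k t) τ := i1.add i2
  have i4 : Integrable (fun t => entDensity (r k t) (K k t) + entDensity (r' k t) (K k t)) τ :=
    (h k).2.add (h' k).2
  have i3 : Integrable (fun t => entDensity (r k t) (K k t) + entDensity (r' k t) (K k t) -
      2 * entDensity (((1 / 2 : ℝ) • r + (1 / 2 : ℝ) • r') k t) (K k t)) τ :=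
    i4.sub ((hm k).2.const_mul 2)
  rw [h.norm_eq, h'.norm_eq, ← integral_add i1 i2, ← integral_add (h k).2 (h' k).2,
    ← integral_const_mul, ← integral_const_mul, ← integral_sub i4 ((hm k).2.const_mul 2),
    ← integral_const_mul,
    ← integral_add (i5.const_mul δ) (i3.const_mul δ⁻¹), L1.norm_eq_integral_norm]
  refine integral_mono_ae (L1.integrable_coeFn _).norm
    ((i5.const_mul δ).add (i3.const_mul δ⁻¹)) ?_
  filter_upwards [(h k).1, (h' k).1, coeFn_combo (r k) (r' k) (1 / 2) (1 / 2),
    Lp.coeFn_sub (r k) (r' k)] with t h1 h2 h4 h5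
  simp only [h5, Pi.sub_apply, Pi.add_apply, Pi.smul_apply, h4, Real.norm_eq_abs]
  exact abs_sub_le_entDensity h1 h2 hδ

/-- The value of the conjugate of the scaled divergence. -/
noncomputable def expTerm (K : Linfn n τ) (ε : ℝ) (a : Linfn n τ) : ℝ :=
  ε * ∑ k, ∫ t, (Real.exp (a k t / ε) - 1) * K k t ∂τ

theorem ae_norm_le_norm_Lp_top (f : Lp ℝ ∞ τ) : ∀ᵐ t ∂τ, ‖f t‖ ≤ ‖f‖ := by
  have h := enorm_ae_le_eLpNormEssSup f τ
  rw [← eLpNorm_exponent_top, ← Lp.enorm_def] at h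
  filter_upwards [h] with t ht
  rw [enorm_eq_nnnorm, enorm_eq_nnnorm, ENNReal.coe_le_coe] at ht
  exact ht

theorem memLp_top_exp_mul (f g : Lp ℝ ∞ τ) (ε : ℝ) :
    MemLp (fun t => Real.exp (f t / ε) * g t) ∞ τ := by
  have hf := (Lp.aestronglyMeasurable f).aemeasurable
  have hg := (Lp.aestronglyMeasurable g).aemeasurable
  refine memLp_top_of_bound ((Real.measurable_exp.comp_aemeasurable
    (hf.div_const ε)).mul hg).aestronglyMeasurable (Real.exp (‖f‖ / |ε|) * ‖g‖) ?_
  filter_upwards [ae_norm_le_norm_Lp_top f, ae_norm_le_norm_Lp_top g] with t h1 h2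
  rw [norm_mul, Real.norm_eq_abs, Real.abs_exp]
  rw [Real.norm_eq_abs] at h1
  have h3 : f t / ε ≤ ‖f‖ / |ε| := (le_abs_self _).trans (by
    rw [abs_div]; exact div_le_div_of_nonneg_right h1 (abs_nonneg ε))
  gcongr

theorem integrable_exp_sub_one_mul [IsFiniteMeasure τ] (f g : Lp ℝ ∞ τ) (ε : ℝ) :
    Integrable (fun t => (Real.exp (f t / ε) - 1) * g t) τ := by
  have := ((memLp_top_exp_mul f g ε).integrable (by simp)).sub (integrable_Lp_top g)
  refine this.congr (ae_of_all _ fun t => ?_)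
  simp only [Pi.sub_apply]
  ring

variable [IsFiniteMeasure τ]

/-- Writing the Fenchel-Young gap as an integral of pointwise gaps, which are nonnegative, yields
both the integrated inequality and its equality case. -/
theorem entropy_gap_eq {r : L1n n τ} {K : Linfn n τ} (h : FiniteEntropy r K) {ε : ℝ}
    (hε : 0 < ε) (a : Linfn n τ) :
    ε * entropy r K + expTerm K ε a - pairing r a = ε * ∑ k, ∫ t, (entDensity (r k t) (K k t) -
      (r k t * (a k t / ε) - (Real.exp (a k t / ε) - 1) * K k t)) ∂τ := by
  have hsum : pairing r a = ε * ∑ k, ∫ t, r k t * (a k t / ε) ∂τ := by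
    rw [pairing, Finset.mul_sum]
    refine Finset.sum_congr rfl fun k _ => ?_
    rw [← integral_const_mul]
    refine integral_congr_ae (ae_of_all _ fun t => ?_)
    simp only
    field_simp
  rw [hsum, entropy, expTerm, ← mul_add, ← mul_sub, ← Finset.sum_add_distrib,
    ← Finset.sum_sub_distrib]
  congr 1
  refine Finset.sum_congr rfl fun k _ => ?_
  have i1 : Integrable (fun t => r k t * (a k t / ε)) τ := by
    simpa [mul_div_assoc] using (integrable_mul_Lp_top (r k) (a k)).div_const ε
  have i2 := integrable_exp_sub_one_mul (a k) (K k) ε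
  have i3 : Integrable (fun t => r k t * (a k t / ε) - (Real.exp (a k t / ε) - 1) * K k t) τ :=
    i1.sub i2
  rw [integral_sub (h k).2 i3, integral_sub i1 i2]
  ring

theorem entropy_gap_integrable {r : L1n n τ} {K : Linfn n τ} (h : FiniteEntropy r K) {ε : ℝ}
    (a : Linfn n τ) (k : Fin n) :
    Integrable (fun t => entDensity (r k t) (K k t) -
      (r k t * (a k t / ε) - (Real.exp (a k t / ε) - 1) * K k t)) τ := by
  have i1 : Integrable (fun t => r k t * (a k t / ε)) τ := by
    simpa [mul_div_assoc] using (integrable_mul_Lp_top (r k) (a k)).div_const ε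
  exact (h k).2.sub (i1.sub (integrable_exp_sub_one_mul (a k) (K k) ε))

theorem pairing_le_entropy {r : L1n n τ} {K : Linfn n τ} (h : FiniteEntropy r K) {ε : ℝ}
    (hε : 0 < ε) (a : Linfn n τ) : pairing r a ≤ ε * entropy r K + expTerm K ε a := by
  rw [← sub_nonneg, entropy_gap_eq h hε]
  refine mul_nonneg hε.le (Finset.sum_nonneg fun k _ => integral_nonneg_of_ae ?_)
  filter_upwards [(h k).1] with t ht
  exact sub_nonneg.2 (mul_sub_le_entDensity ht _)

theorem pairing_eq_entropy_iff {r : L1n n τ} {K : Linfn n τ} (h : FiniteEntropy r K) {ε : ℝ}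
    (hε : 0 < ε) (a : Linfn n τ) : pairing r a = ε * entropy r K + expTerm K ε a ↔
      ∀ k, ∀ᵐ t ∂τ, r k t = K k t * Real.exp (a k t / ε) := by
  have hnn : ∀ k, 0 ≤ᵐ[τ] fun t => entDensity (r k t) (K k t) -
      (r k t * (a k t / ε) - (Real.exp (a k t / ε) - 1) * K k t) := fun k => by
    filter_upwards [(h k).1] with t ht
    exact sub_nonneg.2 (mul_sub_le_entDensity ht _)
  rw [eq_comm, ← sub_eq_zero, entropy_gap_eq h hε, mul_eq_zero, or_iff_right hε.ne',
    Finset.sum_eq_zero_iff_of_nonneg fun k _ => integral_nonneg_of_ae (hnn k)]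
  refine ⟨fun H k => ?_, fun H k _ => ?_⟩
  · have h0 := (integral_eq_zero_iff_of_nonneg_ae (hnn k)
      (entropy_gap_integrable h a k)).1 (H k (Finset.mem_univ _))
    filter_upwards [h0, (h k).1] with t ht hadm
    exact (mul_sub_eq_entDensity_iff hadm _).1 (sub_eq_zero.1 ht).symm
  · refine (integral_eq_zero_iff_of_nonneg_ae (hnn k) (entropy_gap_integrable h a k)).2 ?_
    filter_upwards [H k, (h k).1] with t ht hadm
    exact sub_eq_zero.2 ((mul_sub_eq_entDensity_iff hadm _).2 ht).symm

theorem FiniteEntropy.of_eq_mul_exp {r : L1n n τ} {K : Linfn n τ} (hK : ∀ k, 0 ≤ K k) {ε : ℝ}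
    {a : Linfn n τ} (h : ∀ k, ∀ᵐ t ∂τ, r k t = K k t * Real.exp (a k t / ε)) :
    FiniteEntropy r K := by
  intro k
  have hadm : ∀ᵐ t ∂τ, EntAdmissible (r k t) (K k t) := by
    filter_upwards [h k, (Lp.coeFn_nonneg _).2 (hK k)] with t ht hKt
    rw [ht]
    exact ⟨mul_nonneg hKt (Real.exp_pos _).le, hKt, fun h0 => by simp [h0]⟩
  refine ⟨hadm, ?_⟩
  -- The density is integrable because, in the equality case of Fenchel-Young, it coincides with an
  -- integrable expression free of `log`.
  have i1 : Integrable (fun t => r k t * (a k t / ε)) τ := by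
    simpa [mul_div_assoc] using (integrable_mul_Lp_top (r k) (a k)).div_const ε
  refine (i1.sub (integrable_exp_sub_one_mul (a k) (K k) ε)).congr ?_
  filter_upwards [h k, hadm] with t ht hadm
  exact (mul_sub_eq_entDensity_iff hadm _).2 ht

theorem exists_eq_mul_exp (K : Linfn n τ) (ε : ℝ) (a : Linfn n τ) :
    ∃ r : L1n n τ, ∀ k, ∀ᵐ t ∂τ, r k t = K k t * Real.exp (a k t / ε) := by
  have hint : ∀ k, MemLp (fun t => Real.exp (a k t / ε) * K k t) 1 τ := fun k =>
    (memLp_top_exp_mul (a k) (K k) ε).mono_exponent le_top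
  refine ⟨fun k => (hint k).toLp _, fun k => ?_⟩
  filter_upwards [(hint k).coeFn_toLp] with t ht
  rw [ht, mul_comm]

end Divergence

/-! ### Proper convex functionals, conjugates and subgradients. -/

section Functionals

variable {n : ℕ} {T : Type*} [MeasurableSpace T] {τ : Measure T} {F : L1n n τ → EReal}

theorem exists_real_eq {x : EReal} (hb : x ≠ ⊥) (ht : x ≠ ⊤) : ∃ y : ℝ, x = y :=
  ⟨x.toReal, (EReal.coe_toReal ht hb).symm⟩

/-- The identity from the norm topology to the weak topology is continuous. -/
theorem IsWeaklyLSC.lowerSemicontinuous (h : IsWeaklyLSC F) : LowerSemicontinuous F :=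
  LowerSemicontinuous.comp (g := fun s => toWeakSpaceCLM ℝ (L1n n τ) s) h
    (toWeakSpaceCLM ℝ (L1n n τ)).continuous

theorem IsConvex.le_coe (hF : IsConvex F) {s s' : L1n n τ} {x x' a b : ℝ} (hs : F s = x)
    (hs' : F s' = x') (ha : 0 ≤ a) (hb : 0 ≤ b) (hab : a + b = 1) :
    F (a • s + b • s') ≤ ((a * x + b * x' : ℝ) : EReal) := by
  simpa [hs, hs'] using hF s s' a b ha hb hab

/-- A proper convex lower semicontinuous functional has a continuous affine minorant. -/
theorem exists_affine_minorant (hp : IsProper F) (hc : IsConvex F) (hl : IsWeaklyLSC F) :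
    ∃ (f : L1n n τ →L[ℝ] ℝ) (C : ℝ), ∀ s (x : ℝ), F s = x → f s - C ≤ x := by
  set S : Set (L1n n τ × ℝ) := {p | F p.1 ≤ (p.2 : EReal)} with hS
  have hclosed : IsClosed S :=
    hl.lowerSemicontinuous.isClosed_epigraph.preimage
      (f := fun p : L1n n τ × ℝ => (p.1, (p.2 : EReal)))
      (continuous_fst.prodMk (continuous_coe_real_ereal.comp continuous_snd))
  have hconv : Convex ℝ S := by
    rintro ⟨s, t⟩ hs ⟨s', t'⟩ hs' a b ha hb hab
    simp only [hS, Set.mem_ofPred_eq] at hs hs'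
    obtain ⟨x, hx⟩ := exists_real_eq (hp.1 s) (ne_top_of_le_ne_top (EReal.coe_ne_top _) hs)
    obtain ⟨x', hx'⟩ := exists_real_eq (hp.1 s') (ne_top_of_le_ne_top (EReal.coe_ne_top _) hs')
    rw [hx, EReal.coe_le_coe_iff] at hs
    rw [hx', EReal.coe_le_coe_iff] at hs'
    refine (hc.le_coe hx hx' ha hb hab).trans ?_
    simp only [EReal.coe_le_coe_iff, Prod.snd_add, Prod.smul_snd, smul_eq_mul]
    gcongr
  have hup : ∀ z t t', (z, t) ∈ S → t ≤ t' → (z, t') ∈ S := fun z t t' h htt =>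
    le_trans (show F z ≤ (t : EReal) from h) (EReal.coe_le_coe_iff.2 htt)
  obtain ⟨s₀, hs₀⟩ := hp.2
  obtain ⟨x₀, hx₀⟩ := exists_real_eq (hp.1 s₀) hs₀
  -- The point one unit below the graph over `s₀` lies outside the closed epigraph.
  obtain ⟨f, C, hf⟩ := exists_minorant_of_mem hconv hup (z₀ := s₀) (c := x₀ - 1) (t₀ := x₀)
    (by
      rw [hclosed.closure_eq]
      simp only [hS, Set.mem_ofPred_eq, hx₀, EReal.coe_le_coe_iff]
      linarith)
    (by simp [hS, hx₀])
  exact ⟨f, C, fun s x hx => hf s x hx.le⟩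

theorem coe_sub_le_conj (F : L1n n τ → EReal) (s : L1n n τ) (a : Linfn n τ) :
    (pairing s a : EReal) - F s ≤ conj F a :=
  le_iSup (fun s : L1n n τ => (pairing s a : EReal) - F s) s

theorem conj_ne_bot (hp : IsProper F) (a : Linfn n τ) : conj F a ≠ ⊥ := by
  obtain ⟨s₀, hs₀⟩ := hp.2
  obtain ⟨x₀, hx₀⟩ := exists_real_eq (hp.1 s₀) hs₀
  refine ne_bot_of_le_ne_bot ?_ (coe_sub_le_conj F s₀ a)
  rw [hx₀, ← EReal.coe_sub]
  exact EReal.coe_ne_bot _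

theorem pairing_le_of_conj_eq {s : L1n n τ} {a : Linfn n τ} {x y : ℝ} (hx : F s = x)
    (hy : conj F a = y) : pairing s a ≤ x + y := by
  have := coe_sub_le_conj F s a
  rw [hx, hy, ← EReal.coe_sub, EReal.coe_le_coe_iff] at this
  linarith

theorem conj_le_coe (hb : ∀ s, F s ≠ ⊥) {a : Linfn n τ} {c : ℝ}
    (h : ∀ s (x : ℝ), F s = x → pairing s a - x ≤ c) : conj F a ≤ c := by
  refine iSup_le fun s => ?_
  rcases eq_or_ne (F s) ⊤ with hs | hs
  · simp [hs]
  · obtain ⟨x, hx⟩ := exists_real_eq (hb s) hs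
    rw [hx, ← EReal.coe_sub, EReal.coe_le_coe_iff]
    exact h s x hx

/-- Subgradients are characterized by equality in the Fenchel-Young inequality. -/
theorem mem_subdiff_iff (hp : IsProper F) {s : L1n n τ} {a : Linfn n τ} :
    a ∈ subdiff F s ↔ ∃ x y : ℝ, F s = x ∧ conj F a = y ∧ pairing s a = x + y := by
  constructor
  · rintro ⟨hs, h⟩
    obtain ⟨x, hx⟩ := exists_real_eq (hp.1 s) hs
    have hle : conj F a ≤ ((pairing s a - x : ℝ) : EReal) := conj_le_coe hp.1 fun s' x' hx' => by
      have := h s'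
      rw [hx, hx', ← EReal.coe_add, EReal.coe_le_coe_iff, pairing_sub_left] at this
      linarith
    obtain ⟨y, hy⟩ := exists_real_eq (conj_ne_bot hp a)
      (ne_top_of_le_ne_top (EReal.coe_ne_top _) hle)
    refine ⟨x, y, hx, hy, ?_⟩
    rw [hy, EReal.coe_le_coe_iff] at hle
    linarith [pairing_le_of_conj_eq hx hy]
  · rintro ⟨x, y, hx, hy, hxy⟩
    refine ⟨by rw [hx]; exact EReal.coe_ne_top _, fun s' => ?_⟩
    rcases eq_or_ne (F s') ⊤ with hs' | hs'
    · simp [hs']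
    · obtain ⟨x', hx'⟩ := exists_real_eq (hp.1 s') hs'
      rw [hx, hx', ← EReal.coe_add, EReal.coe_le_coe_iff, pairing_sub_left]
      linarith [pairing_le_of_conj_eq hx' hy]

end Functionals

/-! ### The marginal maps and their adjoint. -/

section Marginals

variable {n : ℕ} {X Y : Type*} [MeasurableSpace X] [MeasurableSpace Y]
  {μ : Measure X} {ν : Measure Y} [IsProbabilityMeasure μ] [IsProbabilityMeasure ν]

theorem projX_coeFn (r : L1n n (μ.prod ν)) (k : Fin n) :
    projX r k =ᵐ[μ] fun x => ∫ y, r k (x, y) ∂ν :=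
  Integrable.coeFn_toL1 _

theorem projY_coeFn (r : L1n n (μ.prod ν)) (k : Fin n) :
    projY r k =ᵐ[ν] fun y => ∫ x, r k (x, y) ∂μ :=
  Integrable.coeFn_toL1 _

theorem ae_swap_of_ae_prod {p : X × Y → Prop} (h : ∀ᵐ z ∂(μ.prod ν), p z) :
    ∀ᵐ y ∂ν, ∀ᵐ x ∂μ, p (x, y) := by
  have h' : ∀ᵐ z ∂(ν.prod μ), p z.swap :=
    (Measure.measurePreserving_swap (μ := ν) (ν := μ)).quasiMeasurePreserving.ae h
  exact Measure.ae_ae_of_ae_prod h'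

theorem projX_add (r r' : L1n n (μ.prod ν)) : projX (r + r') = projX r + projX r' := by
  funext k
  apply Lp.ext
  filter_upwards [projX_coeFn (r + r') k, projX_coeFn r k, projX_coeFn r' k,
    Lp.coeFn_add (projX r k) (projX r' k), Measure.ae_ae_of_ae_prod (Lp.coeFn_add (r k) (r' k)),
    (L1.integrable_coeFn (r k)).prod_right_ae, (L1.integrable_coeFn (r' k)).prod_right_ae]
    with x h1 h2 h3 h4 h5 h6 h7
  have h8 : (projX r + projX r') k x = projX r k x + projX r' k x := h4
  rw [h1, h8, h2, h3, ← integral_add h6 h7]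
  exact integral_congr_ae h5

theorem projY_add (r r' : L1n n (μ.prod ν)) : projY (r + r') = projY r + projY r' := by
  funext k
  apply Lp.ext
  filter_upwards [projY_coeFn (r + r') k, projY_coeFn r k, projY_coeFn r' k,
    Lp.coeFn_add (projY r k) (projY r' k), ae_swap_of_ae_prod (Lp.coeFn_add (r k) (r' k)),
    (L1.integrable_coeFn (r k)).prod_left_ae, (L1.integrable_coeFn (r' k)).prod_left_ae]
    with x h1 h2 h3 h4 h5 h6 h7
  have h8 : (projY r + projY r') k x = projY r k x + projY r' k x := h4
  rw [h1, h8, h2, h3, ← integral_add h6 h7]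
  exact integral_congr_ae h5

theorem projX_smul (c : ℝ) (r : L1n n (μ.prod ν)) : projX (c • r) = c • projX r := by
  funext k
  apply Lp.ext
  filter_upwards [projX_coeFn (c • r) k, projX_coeFn r k, Lp.coeFn_smul c (projX r k),
    Measure.ae_ae_of_ae_prod (Lp.coeFn_smul c (r k))] with x h1 h2 h3 h4
  have h5 : (c • projX r) k x = c • projX r k x := h3
  rw [h1, h5, h2, ← integral_smul]
  exact integral_congr_ae h4

theorem projY_smul (c : ℝ) (r : L1n n (μ.prod ν)) : projY (c • r) = c • projY r := by
  funext k
  apply Lp.ext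
  filter_upwards [projY_coeFn (c • r) k, projY_coeFn r k, Lp.coeFn_smul c (projY r k),
    ae_swap_of_ae_prod (Lp.coeFn_smul c (r k))] with x h1 h2 h3 h4
  have h5 : (c • projY r) k x = c • projY r k x := h3
  rw [h1, h5, h2, ← integral_smul]
  exact integral_congr_ae h4

theorem norm_projX_le (r : L1n n (μ.prod ν)) : ‖projX r‖ ≤ ‖r‖ := by
  refine (pi_norm_le_iff_of_nonneg (norm_nonneg _)).2 fun k => (?_ : _ ≤ ‖r k‖).trans
    (norm_le_pi_norm r k)
  have hr := L1.integrable_coeFn (r k)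
  rw [L1.norm_eq_integral_norm, L1.norm_eq_integral_norm, integral_prod _ hr.norm]
  refine integral_mono_ae (L1.integrable_coeFn _).norm hr.norm.integral_prod_left ?_
  filter_upwards [projX_coeFn r k] with x hx
  rw [hx]
  exact norm_integral_le_integral_norm _

theorem norm_projY_le (r : L1n n (μ.prod ν)) : ‖projY r‖ ≤ ‖r‖ := by
  refine (pi_norm_le_iff_of_nonneg (norm_nonneg _)).2 fun k => (?_ : _ ≤ ‖r k‖).trans
    (norm_le_pi_norm r k)
  have hr := L1.integrable_coeFn (r k)
  rw [L1.norm_eq_integral_norm, L1.norm_eq_integral_norm, integral_prod_symm _ hr.norm]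
  refine integral_mono_ae (L1.integrable_coeFn _).norm hr.norm.integral_prod_right ?_
  filter_upwards [projY_coeFn r k] with x hx
  rw [hx]
  exact norm_integral_le_integral_norm _

/-- The first marginal as a continuous linear map. -/
noncomputable def projXL : L1n n (μ.prod ν) →L[ℝ] L1n n μ :=
  LinearMap.mkContinuous ⟨⟨projX, projX_add⟩, projX_smul⟩ 1 fun r => by
    simpa using norm_projX_le r

/-- The second marginal as a continuous linear map. -/
noncomputable def projYL : L1n n (μ.prod ν) →L[ℝ] L1n n ν :=
  LinearMap.mkContinuous ⟨⟨projY, projY_add⟩, projY_smul⟩ 1 fun r => by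
    simpa using norm_projY_le r

theorem osum_coeFn (u : Linfn n μ) (v : Linfn n ν) (k : Fin n) :
    osum u v k =ᵐ[μ.prod ν] fun z => u k z.1 + v k z.2 := by
  filter_upwards [Lp.coeFn_add
      (Lp.compMeasurePreserving Prod.fst (measurePreserving_fst (μ := μ) (ν := ν)) (u k))
      (Lp.compMeasurePreserving Prod.snd (measurePreserving_snd (μ := μ) (ν := ν)) (v k)),
    Lp.coeFn_compMeasurePreserving (u k) (measurePreserving_fst (μ := μ) (ν := ν)),
    Lp.coeFn_compMeasurePreserving (v k) (measurePreserving_snd (μ := μ) (ν := ν))] with z h1 h2 h3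
  simp only [osum]
  rw [h1, Pi.add_apply, h2, h3]
  rfl

/-- `u ⊕ v` is the image of `(u, v)` under the adjoint of the marginal map. -/
theorem pairing_osum (r : L1n n (μ.prod ν)) (u : Linfn n μ) (v : Linfn n ν) :
    pairing r (osum u v) = pairing (projX r) u + pairing (projY r) v := by
  simp only [pairing]
  rw [← Finset.sum_add_distrib]
  refine Finset.sum_congr rfl fun k _ => ?_
  have hu : Integrable (fun z : X × Y => r k z * u k z.1) (μ.prod ν) := by
    refine (integrable_mul_Lp_top (r k) (Lp.compMeasurePreserving Prod.fst
      (measurePreserving_fst (μ := μ) (ν := ν)) (u k))).congr ?_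
    filter_upwards [Lp.coeFn_compMeasurePreserving (u k)
      (measurePreserving_fst (μ := μ) (ν := ν))] with z hz
    rw [hz]; rfl
  have hv : Integrable (fun z : X × Y => r k z * v k z.2) (μ.prod ν) := by
    refine (integrable_mul_Lp_top (r k) (Lp.compMeasurePreserving Prod.snd
      (measurePreserving_snd (μ := μ) (ν := ν)) (v k))).congr ?_
    filter_upwards [Lp.coeFn_compMeasurePreserving (v k)
      (measurePreserving_snd (μ := μ) (ν := ν))] with z hz
    rw [hz]; rfl
  calc ∫ z, r k z * osum u v k z ∂(μ.prod ν)
      = ∫ z, (r k z * u k z.1 + r k z * v k z.2) ∂(μ.prod ν) := by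
        refine integral_congr_ae ?_
        filter_upwards [osum_coeFn u v k] with z hz
        rw [hz, mul_add]
    _ = ∫ x, projX r k x * u k x ∂μ + ∫ y, projY r k y * v k y ∂ν := by
        rw [integral_add hu hv, integral_prod _ hu, integral_prod_symm _ hv]
        congr 1
        · refine integral_congr_ae ?_
          filter_upwards [projX_coeFn r k] with x hx
          rw [hx, ← integral_mul_const]
        · refine integral_congr_ae ?_
          filter_upwards [projY_coeFn r k] with y hy
          rw [hy, ← integral_mul_const]

end Marginals

/-! ### The perturbed entropic problem and its dual. -/

section Duality

variable {n : ℕ} {X Y : Type*} [MeasurableSpace X] [MeasurableSpace Y]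
  {μ : Measure X} {ν : Measure Y} [IsProbabilityMeasure μ] [IsProbabilityMeasure ν]
  {F₁ : L1n n μ → EReal} {F₂ : L1n n ν → EReal} {K : Linfn n (μ.prod ν)} {ε : ℝ}

theorem entropyTerm_eq_coe (K : Linfn n (μ.prod ν)) (hε : 0 < ε) (r : L1n n (μ.prod ν)) :
    entropyTerm K ε r = ((ENNReal.ofReal ε *
      KL (μ.prod ν) (fun k => ⇑(r k)) (fun k => ⇑(K k)) : ℝ≥0∞) : EReal) := by
  rw [entropyTerm, EReal.coe_ennreal_mul, EReal.coe_ennreal_ofReal, max_eq_left hε.le]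

theorem entropyTerm_ne_bot (hε : 0 < ε) (r : L1n n (μ.prod ν)) : entropyTerm K ε r ≠ ⊥ := by
  rw [entropyTerm_eq_coe K hε]
  exact EReal.coe_ennreal_ne_bot _

theorem FiniteEntropy.entropyTerm_eq (hε : 0 < ε) {r : L1n n (μ.prod ν)}
    (h : FiniteEntropy r K) : entropyTerm K ε r = ((ε * entropy r K : ℝ) : EReal) := by
  rw [entropyTerm_eq_coe K hε, h.KL_eq, ← ENNReal.ofReal_mul hε.le, EReal.coe_ennreal_ofReal,
    max_eq_left (mul_nonneg hε.le h.entropy_nonneg)]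

theorem finiteEntropy_of_entropyTerm_ne_top (hε : 0 < ε) {r : L1n n (μ.prod ν)}
    (h : entropyTerm K ε r ≠ ⊤) : FiniteEntropy r K := by
  refine finiteEntropy_of_KL_ne_top fun htop => h ?_
  rw [entropyTerm_eq_coe K hε, htop, ENNReal.mul_top (by simpa using hε)]
  rfl

theorem lowerSemicontinuous_entropyTerm (K : Linfn n (μ.prod ν)) (hε : 0 < ε) :
    LowerSemicontinuous (entropyTerm K ε) := by
  have h1 : Continuous fun x : ℝ≥0∞ => ((ENNReal.ofReal ε * x : ℝ≥0∞) : EReal) :=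
    continuous_coe_ennreal_ereal.comp (ENNReal.continuous_const_mul ENNReal.ofReal_ne_top)
  have h2 : Monotone fun x : ℝ≥0∞ => ((ENNReal.ofReal ε * x : ℝ≥0∞) : EReal) := fun x y hxy => by
    simp only [EReal.coe_ennreal_le_coe_ennreal_iff]
    gcongr
  have := h1.comp_lowerSemicontinuous (lowerSemicontinuous_KL K) h2
  refine (funext fun r => entropyTerm_eq_coe K hε r : entropyTerm K ε = _) ▸ this

/-- The conjugate of the scaled Kullback-Leibler divergence. -/
theorem conj_entropyTerm (hK : ∀ k, 0 ≤ K k) (hε : 0 < ε) (a : Linfn n (μ.prod ν)) :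
    conj (entropyTerm K ε) a = (expTerm K ε a : EReal) := by
  refine le_antisymm (conj_le_coe (entropyTerm_ne_bot hε) fun r x hx => ?_) ?_
  · have hr : FiniteEntropy r K := finiteEntropy_of_entropyTerm_ne_top hε (by simp [hx])
    rw [hr.entropyTerm_eq hε, EReal.coe_eq_coe_iff] at hx
    linarith [pairing_le_entropy hr hε a]
  -- The supremum is attained at `K * exp (a / ε)`, the equality case of Fenchel-Young.
  · obtain ⟨r, hr⟩ := exists_eq_mul_exp K ε a
    have hfin := FiniteEntropy.of_eq_mul_exp hK hr
    have h1 := (pairing_eq_entropy_iff hfin hε a).2 hr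
    refine le_trans (le_of_eq ?_) (coe_sub_le_conj _ r a)
    rw [hfin.entropyTerm_eq hε, ← EReal.coe_sub, h1]
    simp

/-- The primal objective with the arguments of `F₁` and `F₂` perturbed. -/
noncomputable def perturbed (F₁ : L1n n μ → EReal) (F₂ : L1n n ν → EReal)
    (K : Linfn n (μ.prod ν)) (ε : ℝ) (r : L1n n (μ.prod ν)) (z : L1n n μ × L1n n ν) : EReal :=
  F₁ (projX r + z.1) + F₂ (projY r + z.2) + entropyTerm K ε r

theorem perturbed_zero (r : L1n n (μ.prod ν)) : perturbed F₁ F₂ K ε r 0 = primal F₁ F₂ K ε r := by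
  simp [perturbed, primal]

theorem exists_of_perturbed_ne_top (hp₁ : IsProper F₁) (hp₂ : IsProper F₂) (hε : 0 < ε)
    {r : L1n n (μ.prod ν)} {z : L1n n μ × L1n n ν} (h : perturbed F₁ F₂ K ε r z ≠ ⊤) :
    FiniteEntropy r K ∧ ∃ x₁ x₂ : ℝ, F₁ (projX r + z.1) = x₁ ∧ F₂ (projY r + z.2) = x₂ ∧
      perturbed F₁ F₂ K ε r z = ((x₁ + x₂ + ε * entropy r K : ℝ) : EReal) := by
  have hb₁ := hp₁.1 (projX r + z.1)
  have hb₂ := hp₂.1 (projY r + z.2)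
  have hb₃ := entropyTerm_ne_bot (K := K) hε r
  have ht₁ : F₁ (projX r + z.1) ≠ ⊤ := fun h1 => h (by
    rw [perturbed, h1, EReal.top_add_of_ne_bot hb₂, EReal.top_add_of_ne_bot hb₃])
  have ht₂ : F₂ (projY r + z.2) ≠ ⊤ := fun h1 => h (by
    rw [perturbed, h1, EReal.add_top_of_ne_bot hb₁, EReal.top_add_of_ne_bot hb₃])
  obtain ⟨x₁, hx₁⟩ := exists_real_eq hb₁ ht₁
  obtain ⟨x₂, hx₂⟩ := exists_real_eq hb₂ ht₂
  have ht₃ : entropyTerm K ε r ≠ ⊤ := fun h1 => h (by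
    rw [perturbed, h1, hx₁, hx₂, ← EReal.coe_add, EReal.coe_add_top])
  have hfin := finiteEntropy_of_entropyTerm_ne_top hε ht₃
  refine ⟨hfin, x₁, x₂, hx₁, hx₂, ?_⟩
  rw [perturbed, hx₁, hx₂, hfin.entropyTerm_eq hε]
  norm_cast

theorem exists_of_perturbed_le (hp₁ : IsProper F₁) (hp₂ : IsProper F₂) (hε : 0 < ε)
    {r : L1n n (μ.prod ν)} {z : L1n n μ × L1n n ν} {t : ℝ} (h : perturbed F₁ F₂ K ε r z ≤ t) :
    FiniteEntropy r K ∧ ∃ x₁ x₂ : ℝ, F₁ (projX r + z.1) = x₁ ∧ F₂ (projY r + z.2) = x₂ ∧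
      x₁ + x₂ + ε * entropy r K ≤ t := by
  obtain ⟨hfin, x₁, x₂, h₁, h₂, h₃⟩ := exists_of_perturbed_ne_top hp₁ hp₂ hε
    (ne_top_of_le_ne_top (EReal.coe_ne_top _) h)
  rw [h₃, EReal.coe_le_coe_iff] at h
  exact ⟨hfin, x₁, x₂, h₁, h₂, h⟩

theorem perturbed_combo_le (hc₁ : IsConvex F₁) (hc₂ : IsConvex F₂) (hε : 0 < ε)
    {r r' : L1n n (μ.prod ν)} {z z' : L1n n μ × L1n n ν} (hr : FiniteEntropy r K)
    (hr' : FiniteEntropy r' K) {x₁ x₂ x₁' x₂' a b : ℝ}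
    (h₁ : F₁ (projX r + z.1) = x₁) (h₂ : F₂ (projY r + z.2) = x₂)
    (h₁' : F₁ (projX r' + z'.1) = x₁') (h₂' : F₂ (projY r' + z'.2) = x₂')
    (ha : 0 ≤ a) (hb : 0 ≤ b) (hab : a + b = 1) :
    perturbed F₁ F₂ K ε (a • r + b • r') (a • z + b • z') ≤
      (((a * x₁ + b * x₁') + (a * x₂ + b * x₂') + ε * entropy (a • r + b • r') K : ℝ) :
        EReal) := by
  have e₁ : projX (a • r + b • r') + (a • z + b • z').1 =
      a • (projX r + z.1) + b • (projX r' + z'.1) := by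
    rw [projX_add, projX_smul, projX_smul, Prod.fst_add, Prod.smul_fst, Prod.smul_fst]
    module
  have e₂ : projY (a • r + b • r') + (a • z + b • z').2 =
      a • (projY r + z.2) + b • (projY r' + z'.2) := by
    rw [projY_add, projY_smul, projY_smul, Prod.snd_add, Prod.smul_snd, Prod.smul_snd]
    module
  rw [perturbed, e₁, e₂, (hr.combo hr' ha hb hab).entropyTerm_eq hε, EReal.coe_add, EReal.coe_add]
  exact add_le_add (add_le_add (hc₁.le_coe h₁ h₁' ha hb hab) (hc₂.le_coe h₂ h₂' ha hb hab)) le_rfl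

theorem perturbed_convex (hp₁ : IsProper F₁) (hp₂ : IsProper F₂) (hc₁ : IsConvex F₁)
    (hc₂ : IsConvex F₂) (hε : 0 < ε) (r r' : L1n n (μ.prod ν)) (z z' : L1n n μ × L1n n ν)
    (t t' a b : ℝ) (h : perturbed F₁ F₂ K ε r z ≤ t) (h' : perturbed F₁ F₂ K ε r' z' ≤ t')
    (ha : 0 ≤ a) (hb : 0 ≤ b) (hab : a + b = 1) :
    perturbed F₁ F₂ K ε (a • r + b • r') (a • z + b • z') ≤
      ((a * t + b * t' : ℝ) : EReal) := by
  obtain ⟨hr, x₁, x₂, h₁, h₂, h₃⟩ := exists_of_perturbed_le hp₁ hp₂ hε h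
  obtain ⟨hr', x₁', x₂', h₁', h₂', h₃'⟩ := exists_of_perturbed_le hp₁ hp₂ hε h'
  refine (perturbed_combo_le hc₁ hc₂ hε hr hr' h₁ h₂ h₁' h₂' ha hb hab).trans ?_
  rw [EReal.coe_le_coe_iff]
  have e := mul_le_mul_of_nonneg_left (entropy_combo_le hr hr' ha hb hab) hε.le
  have e1 := mul_le_mul_of_nonneg_left h₃ ha
  have e2 := mul_le_mul_of_nonneg_left h₃' hb
  linarith

theorem lowerSemicontinuous_perturbed (hp₁ : IsProper F₁) (hp₂ : IsProper F₂)
    (hl₁ : IsWeaklyLSC F₁) (hl₂ : IsWeaklyLSC F₂) (hε : 0 < ε) :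
    LowerSemicontinuous fun p : L1n n (μ.prod ν) × (L1n n μ × L1n n ν) =>
      perturbed F₁ F₂ K ε p.1 p.2 := by
  have c₁ : Continuous fun p : L1n n (μ.prod ν) × (L1n n μ × L1n n ν) => projX p.1 + p.2.1 :=
    (projXL.continuous.comp continuous_fst).add (continuous_fst.comp continuous_snd)
  have c₂ : Continuous fun p : L1n n (μ.prod ν) × (L1n n μ × L1n n ν) => projY p.1 + p.2.2 :=
    (projYL.continuous.comp continuous_fst).add (continuous_snd.comp continuous_snd)
  refine ((hl₁.lowerSemicontinuous.comp c₁).add' (hl₂.lowerSemicontinuous.comp c₂)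
    fun p => ?_).add' ((lowerSemicontinuous_entropyTerm K hε).comp continuous_fst) fun p => ?_
  -- Since no summand is `⊥`, the form `∞ - ∞` never occurs and addition is continuous at the values
  -- in question.
  · exact EReal.continuousAt_add (.inr (hp₂.1 _)) (.inl (hp₁.1 _))
  · exact EReal.continuousAt_add (.inr (entropyTerm_ne_bot hε _))
      (.inl (EReal.add_ne_bot_iff.2 ⟨hp₁.1 _, hp₂.1 _⟩))

/-- Affine minorants of `F₁` and `F₂` leave a linear term `g r`, which half of the entropy absorbs
by superlinear growth with slope `2 * ‖g‖ / ε`. The other half stays in the bound in order to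
control `r` on sublevel sets. -/
theorem exists_perturbed_lower_bound (hp₁ : IsProper F₁) (hp₂ : IsProper F₂) (hc₁ : IsConvex F₁)
    (hc₂ : IsConvex F₂) (hl₁ : IsWeaklyLSC F₁) (hl₂ : IsWeaklyLSC F₂) (hε : 0 < ε) :
    ∃ (f : (L1n n μ × L1n n ν) →L[ℝ] ℝ) (C : ℝ), ∀ r z (t : ℝ), perturbed F₁ F₂ K ε r z ≤ t →
      f z - C + ε / 2 * entropy r K ≤ t := by
  obtain ⟨f₁, C₁, hf₁⟩ := exists_affine_minorant hp₁ hc₁ hl₁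
  obtain ⟨f₂, C₂, hf₂⟩ := exists_affine_minorant hp₂ hc₂ hl₂
  set g : L1n n (μ.prod ν) →L[ℝ] ℝ := f₁.comp projXL + f₂.comp projYL with hg
  set B := (Real.exp (2 * ‖g‖ / ε) - 1) * ∑ k, ∫ t, K k t ∂(μ.prod ν) with hB
  refine ⟨f₁.comp (ContinuousLinearMap.fst ℝ (L1n n μ) (L1n n ν)) +
    f₂.comp (ContinuousLinearMap.snd ℝ (L1n n μ) (L1n n ν)), C₁ + C₂ + ε / 2 * B, fun r z t h => ?_⟩
  obtain ⟨hr, x₁, x₂, h₁, h₂, h₃⟩ := exists_of_perturbed_le hp₁ hp₂ hε h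
  have e₁ := hf₁ _ _ h₁
  have e₂ := hf₂ _ _ h₂
  rw [map_add] at e₁ e₂
  have e₃ := mul_norm_le_entropy hr (2 * ‖g‖ / ε)
  have e₄ : ‖r‖ ≤ ∑ k, ‖r k‖ := pi_norm_le_iff_of_nonneg
    (Finset.sum_nonneg fun _ _ => norm_nonneg _) |>.2 fun k =>
      Finset.single_le_sum (f := fun k => ‖r k‖) (fun _ _ => norm_nonneg _) (Finset.mem_univ k)
  have e₅ : -(‖g‖ * ‖r‖) ≤ g r := (abs_le.1 (g.le_opNorm r)).1
  have e₆ : g r = f₁ (projX r) + f₂ (projY r) := rfl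
  have e₇ := mul_le_mul_of_nonneg_left e₄ (norm_nonneg g)
  have e₈ := mul_le_mul_of_nonneg_left e₃ (half_pos hε).le
  have e₉ : ε / 2 * (2 * ‖g‖ / ε * ∑ k, ‖r k‖) = ‖g‖ * ∑ k, ‖r k‖ := by field_simp
  rw [e₉, mul_add] at e₈
  have e₁₀ : (f₁.comp (ContinuousLinearMap.fst ℝ (L1n n μ) (L1n n ν)) +
    f₂.comp (ContinuousLinearMap.snd ℝ (L1n n μ) (L1n n ν))) z = f₁ z.1 + f₂ z.2 := rfl
  rw [e₁₀]
  linarith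

theorem perturbed_uniformly_convex (hp₁ : IsProper F₁) (hp₂ : IsProper F₂) (hc₁ : IsConvex F₁)
    (hc₂ : IsConvex F₂) (hl₁ : IsWeaklyLSC F₁) (hl₂ : IsWeaklyLSC F₂) (hε : 0 < ε)
    (M η : ℝ) (hη : 0 < η) : ∃ δ > 0, ∀ (r r' : L1n n (μ.prod ν)) (z z' : L1n n μ × L1n n ν)
      (t t' : ℝ), ‖z‖ ≤ 1 → ‖z'‖ ≤ 1 → t ≤ M → t' ≤ M → perturbed F₁ F₂ K ε r z ≤ t →
      perturbed F₁ F₂ K ε r' z' ≤ t' → η ≤ ‖r - r'‖ →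
      perturbed F₁ F₂ K ε ((1 / 2 : ℝ) • r + (1 / 2 : ℝ) • r')
        ((1 / 2 : ℝ) • z + (1 / 2 : ℝ) • z') ≤ (((t + t') / 2 - δ : ℝ) : EReal) := by
  obtain ⟨f, C, hf⟩ := exists_perturbed_lower_bound (K := K) hp₁ hp₂ hc₁ hc₂ hl₁ hl₂ hε
  -- A bound for the mass of `r`: the lower bound controls the entropy, and growth with slope `1`
  -- converts this to mass. The maximum with `1` only keeps `L` positive.
  set L := max 1 (2 / ε * (M + C + ‖f‖) + (Real.exp 1 - 1) * ∑ k, ∫ t, K k t ∂(μ.prod ν)) with hL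
  have hL0 : 0 < L := lt_max_of_lt_left one_pos
  have hbound : ∀ r z (t : ℝ), ‖z‖ ≤ 1 → t ≤ M → perturbed F₁ F₂ K ε r z ≤ t →
      ∑ k, ‖r k‖ ≤ L := by
    intro r z t hz ht h
    have h1 := hf r z t h
    have h2 : -(‖f‖ * ‖z‖) ≤ f z := (abs_le.1 (f.le_opNorm z)).1
    have h3 := mul_le_mul_of_nonneg_left hz (norm_nonneg f)
    have h4 : ε / 2 * entropy r K ≤ M + C + ‖f‖ := by linarith
    have h5 := mul_le_mul_of_nonneg_left h4 (show 0 ≤ 2 / ε by positivity)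
    have h6 : 2 / ε * (ε / 2 * entropy r K) = entropy r K := by field_simp
    have h7 := mul_norm_le_entropy (exists_of_perturbed_le hp₁ hp₂ hε h).1 1
    refine le_trans ?_ (le_max_right _ _)
    linarith
  -- With this weight the mass term in `sum_norm_sub_le_entropy` is at most `δ₀ * (2 * L) = η / 2`.
  -- The convexity gap must supply the remaining `η / 2`, so the midpoint value drops by at least `ε
  -- * (δ₀ * η / 4)`.
  set δ₀ := η / (4 * L) with hδ₀
  have hδ₀pos : 0 < δ₀ := by positivity
  refine ⟨ε * (δ₀ * η / 4), by positivity, fun r r' z z' t t' hz hz' ht ht' h h' hη' => ?_⟩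
  have hN := hbound r z t hz ht h
  have hN' := hbound r' z' t' hz' ht' h'
  obtain ⟨hr, x₁, x₂, h₁, h₂, h₃⟩ := exists_of_perturbed_le hp₁ hp₂ hε h
  obtain ⟨hr', x₁', x₂', h₁', h₂', h₃'⟩ := exists_of_perturbed_le hp₁ hp₂ hε h'
  refine (perturbed_combo_le hc₁ hc₂ hε hr hr' h₁ h₂ h₁' h₂' (by norm_num) (by norm_num)
    (by norm_num)).trans ?_
  rw [EReal.coe_le_coe_iff]
  have e₁ := sum_norm_sub_le_entropy hr hr' hδ₀pos
  have e₂ : ‖r - r'‖ ≤ ∑ k, ‖r k - r' k‖ := pi_norm_le_iff_of_nonneg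
    (Finset.sum_nonneg fun _ _ => norm_nonneg _) |>.2 fun k =>
      Finset.single_le_sum (f := fun k => ‖r k - r' k‖) (fun _ _ => norm_nonneg _)
        (Finset.mem_univ k)
  have e₃ : δ₀ * (∑ k, ‖r k‖ + ∑ k, ‖r' k‖) ≤ η / 2 := by
    refine (mul_le_mul_of_nonneg_left (add_le_add hN hN') hδ₀pos.le).trans (le_of_eq ?_)
    rw [hδ₀]
    field_simp
    norm_num
  set D := entropy r K + entropy r' K - 2 * entropy ((1 / 2 : ℝ) • r + (1 / 2 : ℝ) • r') K with hD
  have e₄ : η / 2 ≤ δ₀⁻¹ * D := by linarith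
  have e₅ : δ₀ * (η / 2) ≤ D := by
    have := mul_le_mul_of_nonneg_left e₄ hδ₀pos.le
    rwa [mul_inv_cancel_left₀ hδ₀pos.ne'] at this
  have e₆ := mul_le_mul_of_nonneg_left e₅ hε.le
  rw [hD] at e₆
  linarith

theorem exists_of_dual_ne_bot (hp₁ : IsProper F₁) (hp₂ : IsProper F₂)
    {p : Linfn n μ × Linfn n ν} (h : dual F₁ F₂ K ε p ≠ ⊥) :
    ∃ y₁ y₂ : ℝ, conj F₁ (-p.1) = y₁ ∧ conj F₂ (-p.2) = y₂ := by
  refine ⟨_, _, (exists_real_eq (conj_ne_bot hp₁ _) fun h1 => h ?_).choose_spec,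
    (exists_real_eq (conj_ne_bot hp₂ _) fun h1 => h ?_).choose_spec⟩
  · simp [dual, h1, sub_eq_add_neg]
  · simp [dual, h1, sub_eq_add_neg]

theorem dual_eq_coe {p : Linfn n μ × Linfn n ν} {y₁ y₂ : ℝ} (h₁ : conj F₁ (-p.1) = y₁)
    (h₂ : conj F₂ (-p.2) = y₂) :
    dual F₁ F₂ K ε p = ((-y₁ - y₂ - expTerm K ε (osum p.1 p.2) : ℝ) : EReal) := by
  rw [dual, h₁, h₂, expTerm]
  norm_cast

theorem dual_ne_top (hp₁ : IsProper F₁) (hp₂ : IsProper F₂) (p : Linfn n μ × Linfn n ν) :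
    dual F₁ F₂ K ε p ≠ ⊤ := by
  intro h
  obtain ⟨y₁, y₂, h₁, h₂⟩ := exists_of_dual_ne_bot hp₁ hp₂ (by rw [h]; exact top_ne_bot)
  rw [dual_eq_coe h₁ h₂] at h
  exact EReal.coe_ne_top _ h

theorem exists_of_primal_ne_top (hp₁ : IsProper F₁) (hp₂ : IsProper F₂) (hε : 0 < ε)
    {r : L1n n (μ.prod ν)} (h : primal F₁ F₂ K ε r ≠ ⊤) :
    FiniteEntropy r K ∧ ∃ x₁ x₂ : ℝ, F₁ (projX r) = x₁ ∧ F₂ (projY r) = x₂ ∧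
      primal F₁ F₂ K ε r = ((x₁ + x₂ + ε * entropy r K : ℝ) : EReal) := by
  rw [← perturbed_zero] at h ⊢
  simpa using exists_of_perturbed_ne_top hp₁ hp₂ hε h

/-- Add the Fenchel-Young inequalities for `F₁`, `F₂` and the entropy; the pairings cancel because
`u ⊕ v` is the adjoint of the marginals. -/
theorem dual_le_primal (hp₁ : IsProper F₁) (hp₂ : IsProper F₂) (hε : 0 < ε)
    (p : Linfn n μ × Linfn n ν) (r : L1n n (μ.prod ν)) :
    dual F₁ F₂ K ε p ≤ primal F₁ F₂ K ε r := by
  rcases eq_or_ne (dual F₁ F₂ K ε p) ⊥ with hd | hd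
  · simp [hd]
  rcases eq_or_ne (primal F₁ F₂ K ε r) ⊤ with ht | ht
  · simp [ht]
  obtain ⟨y₁, y₂, h₁, h₂⟩ := exists_of_dual_ne_bot hp₁ hp₂ hd
  obtain ⟨hr, x₁, x₂, k₁, k₂, k₃⟩ := exists_of_primal_ne_top hp₁ hp₂ hε ht
  rw [dual_eq_coe h₁ h₂, k₃, EReal.coe_le_coe_iff]
  have g₁ := pairing_le_of_conj_eq k₁ h₁
  have g₂ := pairing_le_of_conj_eq k₂ h₂
  have g₃ := pairing_le_entropy hr hε (osum p.1 p.2)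
  rw [pairing_neg_right] at g₁ g₂
  rw [pairing_osum] at g₃
  linarith

/-- Equality of primal and dual values amounts to the optimality conditions. -/
theorem dual_eq_primal_iff (hp₁ : IsProper F₁) (hp₂ : IsProper F₂) (hK : ∀ k, 0 ≤ K k)
    (hε : 0 < ε) (u : Linfn n μ) (v : Linfn n ν) (r : L1n n (μ.prod ν)) :
    dual F₁ F₂ K ε (u, v) = primal F₁ F₂ K ε r ↔
      -u ∈ subdiff F₁ (projX r) ∧ -v ∈ subdiff F₂ (projY r) ∧
        ∀ k, ∀ᵐ z ∂(μ.prod ν), r k z = K k z * Real.exp (osum u v k z / ε) := by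
  rw [mem_subdiff_iff hp₁, mem_subdiff_iff hp₂]
  constructor
  · intro heq
    have ht : primal F₁ F₂ K ε r ≠ ⊤ := heq ▸ dual_ne_top hp₁ hp₂ _
    obtain ⟨hr, x₁, x₂, k₁, k₂, k₃⟩ := exists_of_primal_ne_top hp₁ hp₂ hε ht
    have hd : dual F₁ F₂ K ε (u, v) ≠ ⊥ := by
      rw [heq, k₃]
      exact EReal.coe_ne_bot _
    obtain ⟨y₁, y₂, h₁, h₂⟩ := exists_of_dual_ne_bot hp₁ hp₂ hd
    rw [dual_eq_coe h₁ h₂, k₃, EReal.coe_eq_coe_iff] at heq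
    simp only at h₁ h₂ heq
    have g₁ := pairing_le_of_conj_eq k₁ h₁
    have g₂ := pairing_le_of_conj_eq k₂ h₂
    have g₃ := pairing_le_entropy hr hε (osum u v)
    have g₄ := pairing_osum r u v
    have n₁ := pairing_neg_right (projX r) u
    have n₂ := pairing_neg_right (projY r) v
    -- Three nonnegative gaps add up to zero, so each of them vanishes.
    exact ⟨⟨x₁, y₁, k₁, h₁, by linarith⟩, ⟨x₂, y₂, k₂, h₂, by linarith⟩,
      (pairing_eq_entropy_iff hr hε _).1 (by linarith)⟩
  · rintro ⟨⟨x₁, y₁, k₁, h₁, e₁⟩, ⟨x₂, y₂, k₂, h₂, e₂⟩, h⟩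
    have hr := FiniteEntropy.of_eq_mul_exp hK h
    have e₃ := (pairing_eq_entropy_iff hr hε _).2 h
    rw [dual_eq_coe (p := (u, v)) h₁ h₂, primal, k₁, k₂, hr.entropyTerm_eq hε, ← EReal.coe_add,
      ← EReal.coe_add, EReal.coe_eq_coe_iff]
    rw [pairing_neg_right] at e₁ e₂
    rw [pairing_osum] at e₃
    simp only
    linarith

/-- An affine minorant of the perturbed problem gives a dual feasible point. -/
theorem exists_le_dual (hp₁ : IsProper F₁) (hp₂ : IsProper F₂) (hK : ∀ k, 0 ≤ K k) (hε : 0 < ε)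
    {c : ℝ} {f : (L1n n μ × L1n n ν) →L[ℝ] ℝ}
    (hf : ∀ r z (t : ℝ), perturbed F₁ F₂ K ε r z ≤ t → c + f z ≤ t) :
    ∃ p, (c : EReal) ≤ dual F₁ F₂ K ε p := by
  obtain ⟨a₁, ha₁⟩ := exists_eq_pairing (f.comp (ContinuousLinearMap.inl ℝ (L1n n μ) (L1n n ν)))
  obtain ⟨a₂, ha₂⟩ := exists_eq_pairing (f.comp (ContinuousLinearMap.inr ℝ (L1n n μ) (L1n n ν)))
  have hfz : ∀ z, f z = pairing z.1 a₁ + pairing z.2 a₂ := fun z => by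
    rw [← ha₁, ← ha₂]
    simp only [ContinuousLinearMap.comp_apply, ContinuousLinearMap.inl_apply,
      ContinuousLinearMap.inr_apply, ← map_add]
    simp
  -- This `r` is optimal in the conjugate of the entropy at `(-a₁) ⊕ (-a₂)`. Choosing `z` as `s₁`
  -- and `s₂` minus its marginals leaves the arguments of `F₁` and `F₂` free, so one `r` handles all
  -- three conjugates.
  obtain ⟨r, hr⟩ := exists_eq_mul_exp K ε (osum (-a₁) (-a₂))
  have hfin := FiniteEntropy.of_eq_mul_exp hK hr
  have hyoung := (pairing_eq_entropy_iff hfin hε _).2 hr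
  rw [pairing_osum, pairing_neg_right, pairing_neg_right] at hyoung
  set e := expTerm K ε (osum (-a₁) (-a₂)) with he
  have key : ∀ s₁ s₂ (x₁ x₂ : ℝ), F₁ s₁ = x₁ → F₂ s₂ = x₂ →
      (pairing s₁ a₁ - x₁) + (pairing s₂ a₂ - x₂) ≤ -c - e := by
    intro s₁ s₂ x₁ x₂ h₁ h₂
    have := hf r (s₁ - projX r, s₂ - projY r) (x₁ + x₂ + ε * entropy r K) (by
      rw [perturbed, hfin.entropyTerm_eq hε]
      simp [h₁, h₂])
    rw [hfz] at this
    simp only [pairing_sub_left] at this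
    linarith
  obtain ⟨s₂, hs₂⟩ := hp₂.2
  obtain ⟨x₂, hx₂⟩ := exists_real_eq (hp₂.1 s₂) hs₂
  -- The two suprema are taken one after the other: with `s₂` fixed in the domain of `F₂`, the
  -- conjugate of `F₁` is finite, and its value then bounds that of `F₂`.
  have hconj₁ : ∀ s₂ (x₂ : ℝ), F₂ s₂ = x₂ →
      conj F₁ a₁ ≤ ((-c - e - (pairing s₂ a₂ - x₂) : ℝ) : EReal) := fun s₂ x₂ h₂ =>
    conj_le_coe hp₁.1 fun s₁ x₁ h₁ => by linarith [key s₁ s₂ x₁ x₂ h₁ h₂]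
  obtain ⟨y₁, hy₁⟩ := exists_real_eq (conj_ne_bot hp₁ a₁)
    (ne_top_of_le_ne_top (EReal.coe_ne_top _) (hconj₁ s₂ x₂ hx₂))
  have hconj₂ : conj F₂ a₂ ≤ ((-c - e - y₁ : ℝ) : EReal) := conj_le_coe hp₂.1 fun s₂ x₂ h₂ => by
    have := hconj₁ s₂ x₂ h₂
    rw [hy₁, EReal.coe_le_coe_iff] at this
    linarith
  obtain ⟨y₂, hy₂⟩ := exists_real_eq (conj_ne_bot hp₂ a₂)
    (ne_top_of_le_ne_top (EReal.coe_ne_top _) hconj₂)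
  rw [hy₂, EReal.coe_le_coe_iff] at hconj₂
  refine ⟨(-a₁, -a₂), ?_⟩
  rw [dual_eq_coe (y₁ := y₁) (y₂ := y₂) (by simpa using hy₁) (by simpa using hy₂),
    EReal.coe_le_coe_iff]
  simp only
  linarith

/-- Strong duality with attainment in the primal problem. -/
theorem exists_primal_eq_iSup_dual (hp₁ : IsProper F₁) (hp₂ : IsProper F₂) (hc₁ : IsConvex F₁)
    (hc₂ : IsConvex F₂) (hl₁ : IsWeaklyLSC F₁) (hl₂ : IsWeaklyLSC F₂) (hK : ∀ k, 0 ≤ K k)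
    (hε : 0 < ε) : ∃ r, primal F₁ F₂ K ε r = ⨆ p, dual F₁ F₂ K ε p := by
  obtain ⟨f, C, hf⟩ := exists_perturbed_lower_bound (K := K) hp₁ hp₂ hc₁ hc₂ hl₁ hl₂ hε
  rcases exists_minimizer_or_minorants (perturbed F₁ F₂ K ε)
    (perturbed_convex hp₁ hp₂ hc₁ hc₂ hε) (lowerSemicontinuous_perturbed hp₁ hp₂ hl₁ hl₂ hε)
    ⟨f, C, fun r z t h => by
      have h1 := hf r z t h
      have h2 := (exists_of_perturbed_le hp₁ hp₂ hε h).1.entropy_nonneg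
      have h3 := mul_nonneg (half_pos hε).le h2
      linarith⟩
    (perturbed_uniformly_convex hp₁ hp₂ hc₁ hc₂ hl₁ hl₂ hε) with ⟨r, c₀, hr, hc⟩ | hall
  · rw [perturbed_zero] at hr
    refine ⟨r, le_antisymm (hr.trans ?_) (iSup_le fun p => dual_le_primal hp₁ hp₂ hε p r)⟩
    refine EReal.ge_of_forall_gt_iff_ge.1 fun c hlt => ?_
    obtain ⟨f, hf⟩ := hc c (by exact_mod_cast hlt)
    obtain ⟨p, hp⟩ := exists_le_dual hp₁ hp₂ hK hε hf
    exact hp.trans (le_iSup (dual F₁ F₂ K ε) p)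
  -- Minorants of arbitrary height make the dual supremum infinite. By weak duality the primal
  -- objective is identically `⊤`, so `0` serves as a minimizer.
  · have htop : ⨆ p, dual F₁ F₂ K ε p = ⊤ := by
      refine EReal.eq_top_iff_forall_lt _ |>.2 fun c => ?_
      obtain ⟨f, hf⟩ := hall (c + 1)
      obtain ⟨p, hp⟩ := exists_le_dual hp₁ hp₂ hK hε hf
      refine lt_of_lt_of_le ?_ (hp.trans (le_iSup (dual F₁ F₂ K ε) p))
      exact_mod_cast lt_add_one c
    refine ⟨0, ?_⟩
    rw [htop, eq_top_iff, ← htop]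
    exact iSup_le fun p => dual_le_primal hp₁ hp₂ hε p 0

/-- By uniform convexity at `z = 0`, the midpoint of two distinct minimizers of finite value would
lie strictly below the minimum. -/
theorem primal_minimizer_unique (hp₁ : IsProper F₁) (hp₂ : IsProper F₂) (hc₁ : IsConvex F₁)
    (hc₂ : IsConvex F₂) (hl₁ : IsWeaklyLSC F₁) (hl₂ : IsWeaklyLSC F₂) (hε : 0 < ε)
    {r r' : L1n n (μ.prod ν)} (hr : IsMinOn (primal F₁ F₂ K ε) Set.univ r)
    (hr' : IsMinOn (primal F₁ F₂ K ε) Set.univ r') (ht : primal F₁ F₂ K ε r ≠ ⊤) : r' = r := by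
  have heq : primal F₁ F₂ K ε r' = primal F₁ F₂ K ε r :=
    le_antisymm (hr' (Set.mem_univ r)) (hr (Set.mem_univ r'))
  obtain ⟨-, x₁, x₂, -, -, hx⟩ := exists_of_primal_ne_top hp₁ hp₂ hε ht
  set c := x₁ + x₂ + ε * entropy r K
  by_contra hne
  obtain ⟨δ, hδ, hun⟩ := perturbed_uniformly_convex (K := K) hp₁ hp₂ hc₁ hc₂ hl₁ hl₂ hε c ‖r - r'‖
    (norm_pos_iff.2 (sub_ne_zero.2 (Ne.symm hne)))
  have h := hun r r' 0 0 c c (by simp) (by simp) le_rfl le_rfl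
    (by rw [perturbed_zero, hx]) (by rw [perturbed_zero, heq, hx]) le_rfl
  rw [smul_zero, add_zero, perturbed_zero] at h
  have h2 := (hr (Set.mem_univ ((1 / 2 : ℝ) • r + (1 / 2 : ℝ) • r'))).trans h
  rw [hx, EReal.coe_le_coe_iff] at h2
  linarith

end Duality

end EntropicDuality

open EntropicDuality in
theorem theorem3p1 {n : ℕ} {X Y : Type*} [MeasurableSpace X] [MeasurableSpace Y]
    (μ : Measure X) (ν : Measure Y) [IsProbabilityMeasure μ] [IsProbabilityMeasure ν]
    (F₁ : L1n n μ → EReal) (F₂ : L1n n ν → EReal)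
    (hF₁_proper : IsProper F₁) (hF₁_convex : IsConvex F₁) (hF₁_lsc : IsWeaklyLSC F₁)
    (hF₂_proper : IsProper F₂) (hF₂_convex : IsConvex F₂) (hF₂_lsc : IsWeaklyLSC F₂)
    (K : Linfn n (μ.prod ν)) (hK : ∀ k, 0 ≤ K k) (ε : ℝ) (hε : 0 < ε) :
    -- the Fenchel-Rockafellar dual problem has the stated explicit form
    (∀ p, fenchelDual F₁ F₂ K ε p = dual F₁ F₂ K ε p) ∧
    -- the primal minimum is attained and equals the dual supremum
    (∃ r, IsMinOn (primal F₁ F₂ K ε) Set.univ r ∧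
      primal F₁ F₂ K ε r = ⨆ p, dual F₁ F₂ K ε p) ∧
    -- the minimizer is unique as soon as the primal problem is feasible
    ((∃ r, primal F₁ F₂ K ε r ≠ ⊤) →
      ∃! r, IsMinOn (primal F₁ F₂ K ε) Set.univ r) ∧
    -- characterization of the dual maximizers
    (∀ r, IsMinOn (primal F₁ F₂ K ε) Set.univ r → ∀ (u : Linfn n μ) (v : Linfn n ν),
      IsMaxOn (dual F₁ F₂ K ε) Set.univ (u, v) ↔
        -u ∈ subdiff F₁ (projX r) ∧ -v ∈ subdiff F₂ (projY r) ∧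
        ∀ k, ∀ᵐ z ∂(μ.prod ν),
          r k z = Real.exp (u k z.1 / ε) * K k z * Real.exp (v k z.2 / ε)) := by
  obtain ⟨r₀, hr₀⟩ := exists_primal_eq_iSup_dual hF₁_proper hF₂_proper hF₁_convex hF₂_convex
    hF₁_lsc hF₂_lsc hK hε
  have hweak := dual_le_primal (K := K) hF₁_proper hF₂_proper hε
  have hmin : IsMinOn (primal F₁ F₂ K ε) Set.univ r₀ := fun r _ => by
    change primal F₁ F₂ K ε r₀ ≤ primal F₁ F₂ K ε r
    rw [hr₀]
    exact iSup_le fun p => hweak p r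
  refine ⟨fun p => ?_, ⟨r₀, hmin, hr₀⟩, fun ⟨r, hr⟩ => ⟨r₀, hmin, fun r' hr' => ?_⟩,
    fun r hr u v => ?_⟩
  · rw [fenchelDual, dual, conj_entropyTerm hK hε, expTerm]
  · exact primal_minimizer_unique hF₁_proper hF₂_proper hF₁_convex hF₂_convex hF₁_lsc hF₂_lsc hε
      hmin hr' (ne_top_of_le_ne_top hr (hmin (Set.mem_univ r)))
  · have hval : primal F₁ F₂ K ε r = ⨆ p, dual F₁ F₂ K ε p :=
      hr₀ ▸ le_antisymm (hr (Set.mem_univ r₀)) (hmin (Set.mem_univ r))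
    -- As the minimum equals the supremum, maximality means that the dual value reaches the primal
    -- value at `r`.
    have hmax : IsMaxOn (dual F₁ F₂ K ε) Set.univ (u, v) ↔
        dual F₁ F₂ K ε (u, v) = primal F₁ F₂ K ε r := by
      rw [hval]
      refine ⟨fun h => le_antisymm (le_iSup _ _) (iSup_le fun p => h (Set.mem_univ p)),
        fun h p _ => ?_⟩
      change dual F₁ F₂ K ε p ≤ dual F₁ F₂ K ε (u, v)
      rw [h]
      exact le_iSup _ p
    rw [hmax, dual_eq_primal_iff hF₁_proper hF₂_proper hK hε]
    refine and_congr_right fun _ => and_congr_right fun _ => forall_congr' fun k => ?_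
    refine Filter.eventually_congr ?_
    filter_upwards [osum_coeFn u v k] with z hz
    rw [hz, add_div, Real.exp_add, mul_comm (Real.exp (u k z.1 / ε)) (K k z), mul_assoc]
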